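/- Let $\mathbb D=\{z\in\mathbb C:|z|<1\}$ and let $A^2(\mathbb D)$ be the Bergman space of holomorphic functions $f$ on $\mathbb D$ with $\|f\|^2=\frac1\pi\int_{\mathbb D}|f(z)|^2\,dz<\infty$, where $dz$ is the area measure. Let $k(z,w)=(1-z\bar w)^{-2}$ be its reproducing kernel. Let $\mathcal P_n$ be the space of polynomials of degree at most $n$, with the norm of $A^2(\mathbb D)$ and reproducing kernel $k_n(z,w)=\sum_{j=0}^n(j+1)(z\bar w)^j$. A set $\Lambda\subseteq\mathbb D$ is called a *sampling set* for $A^2(\mathbb D)$ if there are constants $A,B>0$ such that $$A\|f\|^2\le\sum_{\lambda\in\Lambda}\frac{|f(\lambda)|^2}{k(\lambda,\lambda)}\le B\|f\|^2\qquad\text{for all } f\in A^2(\mathbb D).$$ A sequence $(\Lambda_n)$ of subsets of $\mathbb D$ is called a *Marcinkiewicz–Zygmund (MZ) family* for the polynomials $\mathcal P_n$ in $A^2(\mathbb D)$ if there are constants $A,B>0$ and $n_0\in\mathbb N$ such that, for all $n\ge n_0$, $\Lambda_n$ is finite and $$A\|p\|^2\le\sum_{\lambda\in\Lambda_n}\frac{|p(\lambda)|^2}{k_n(\lambda,\lambda)}\le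 B\|p\|^2\qquad\text{for all } p\in\mathcal P_n.$$ A sequence of sets $\Lambda_n\subseteq\mathbb D$ *converges weakly* to $\Lambda\subseteq\mathbb D$, and $\Lambda$ is then called a weak limit of it, if for every compact disk $D\subseteq\mathbb D$ (of positive radius) the Hausdorff distance between $(\Lambda_n\cap D)\cup\partial D$ and $(\Lambda\cap D)\cup\partial D$ (for the Euclidean metric) tends to $0$ as $n\to\infty$. **Theorem.** (i) Let $\Lambda\subseteq\mathbb D$ be a sampling set for $A^2(\mathbb D)$. Then there is $\gamma_0>0$ such that for every $\gamma\in(0,\gamma_0)$ the sets $\Lambda_n=\Lambda\cap\{z:|z|<1-\gamma/n\}$ form an MZ family for the polynomials $\mathcal P_n$ in $A^2(\mathbb D)$. (ii) Conversely, let $(\Lambda_n)$ be an MZ family for the polynomials $\mathcal P_n$ in $A^2(\mathbb D)$. Then every set $\Lambda\subseteq\mathbb D$ that is a weak limit of $(\Lambda_n)$ or of a subsequence $(\Lambda_{n_j})$ is a sampling set for $A^2(\mathbb D)$. -/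

import Mathlib

open Filter Topology MeasureTheory

noncomputable section

namespace BergmanMZ

/-- The open unit disk `𝔻`. -/
def disk : Set ℂ := Metric.ball 0 1

/-- The squared norm of the Bergman space, `(1/π) ∫_𝔻 |f|²` with respect to area measure. -/
def normSq (f : ℂ → ℂ) : ℝ := (1 / Real.pi) * ∫ z in disk, ‖f z‖ ^ 2

/-- Membership in the Bergman space `A²(𝔻)`: `f` is holomorphic and square integrable on the
disk. (The values of `f` outside of the disk play no role.) -/
def MemBergman (f : ℂ → ℂ) : Prop :=
  DifferentiableOn ℂ f disk ∧ IntegrableOn (fun z => ‖f z‖ ^ 2) disk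

/-- The reproducing kernel `k(z,w) = (1 - z w̄)⁻²` of `A²(𝔻)`. -/
def kernel (z w : ℂ) : ℂ := 1 / (1 - z * (starRingEnd ℂ) w) ^ 2

/-- The reproducing kernel `k_n(z,w) = ∑_{j ≤ n} (j+1) (z w̄)^j` of the space of polynomials of
degree at most `n`, regarded as a subspace of `A²(𝔻)`. -/
def polyKernel (n : ℕ) (z w : ℂ) : ℂ :=
  ∑ j ∈ Finset.range (n + 1), ((j : ℂ) + 1) * (z * (starRingEnd ℂ) w) ^ j

/-- The sampling sum `∑_{λ ∈ Λ} |f(λ)|² / K(λ,λ)`, a sum of nonnegative terms with a value in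
`[0,∞]`. The diagonal of each kernel above is real and positive in the disk. -/
def samplingSum (K : ℂ → ℂ → ℂ) (Λ : Set ℂ) (f : ℂ → ℂ) : ENNReal :=
  ∑' z : Λ, ENNReal.ofReal (‖f z‖ ^ 2 / (K z z).re)

/-- `Λ ⊆ 𝔻` is a sampling set for `A²(𝔻)`. -/
def IsSampling (Λ : Set ℂ) : Prop :=
  Λ ⊆ disk ∧ ∃ A B : ℝ, 0 < A ∧ 0 < B ∧ ∀ f : ℂ → ℂ, MemBergman f →
    ENNReal.ofReal (A * normSq f) ≤ samplingSum kernel Λ f ∧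
      samplingSum kernel Λ f ≤ ENNReal.ofReal (B * normSq f)

/-- `(Λ_n)` is a Marcinkiewicz–Zygmund family for the polynomials of degree at most `n` in
`A²(𝔻)`: the constants `A`, `B` do not depend on `n`, and the conditions are imposed for all
large `n`. -/
def IsMZFamily (Λ : ℕ → Set ℂ) : Prop :=
  (∀ n, Λ n ⊆ disk) ∧ ∃ A B : ℝ, 0 < A ∧ 0 < B ∧ ∃ n₀ : ℕ, ∀ n, n₀ ≤ n →
    (Λ n).Finite ∧ ∀ p : Polynomial ℂ, p.natDegree ≤ n →
      ENNReal.ofReal (A * normSq (fun z => p.eval z)) ≤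
          samplingSum (polyKernel n) (Λ n) (fun z => p.eval z) ∧
        samplingSum (polyKernel n) (Λ n) (fun z => p.eval z) ≤
          ENNReal.ofReal (B * normSq (fun z => p.eval z))

/-- Weak convergence of subsets of the disk: for each compact disk `D ⊆ 𝔻`, the Hausdorff
distance of `(Λ_n ∩ D) ∪ ∂D` and `(Λ ∩ D) ∪ ∂D` tends to zero. -/
def WeaklyConverges (Λs : ℕ → Set ℂ) (Λ : Set ℂ) : Prop :=
  ∀ (c : ℂ) (r : ℝ), 0 < r → Metric.closedBall c r ⊆ disk →
    Tendsto (fun n => Metric.hausdorffEDist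
        ((Λs n ∩ Metric.closedBall c r) ∪ Metric.sphere c r)
        ((Λ ∩ Metric.closedBall c r) ∪ Metric.sphere c r))
      atTop (𝓝 0)

end BergmanMZ

end

open Filter Topology MeasureTheory

noncomputable section

namespace BergmanMZ

/-! Write k_n and k for the two kernels. On the diagonal k_n ≤ k throughout the disk
(`mul_le_div_diagKernel`), and k_n is at least a fixed multiple of k wherever |z|^n stays away from
1 (`div_diagKernel_le`).

(i) On |z| < 1 - γ/n the two weights are comparable uniformly in n, so the upper bound of Λ is
inherited. For the lower bound only the points with |z| ≥ 1 - γ/n are lost. Testing the upper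
sampling bound on kernels limits the number of hyperbolically close points (`card_le_of_close`).
With the sub-mean value property, the lost sum is at most a constant times the integral of |p|² over
an annulus of width 2γ/n. For degree at most n this is O(γ)‖p‖², by orthogonality of the monomials
(`integral_annulus_eval_le`), and a small γ lets half of the lower bound survive.

(ii) Fix a polynomial p and let n grow. Upper bounds pass to finite subsets of Λ, since distinct
limit points have distinct approximants (`WeaklyConverges.sum_le`). For the lower bound
(`WeaklyConverges.le_sum`), testing the upper bound on z^m shows that the points near the circle
contribute little, uniformly in n. The other points cluster at finitely many points of Λ, and
testing on k_m(·,l) shows that at most 8B of them cluster at each l. The multiplicity only costs a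
constant. Parseval's identity makes polynomials dense and extends both bounds to A²(𝔻). -/

/-- The half-open annulus `r ≤ |z| < R`. -/
def annulus (r R : ℝ) : Set ℂ := {z | r ≤ ‖z‖ ∧ ‖z‖ < R}

/-- The polynomial `∑_{j < N} a_j z^j`. -/
def partialSum (a : ℕ → ℂ) (N : ℕ) (z : ℂ) : ℂ := ∑ j ∈ Finset.range N, a j * z ^ j

/-! ### Orthogonality of monomials on annuli -/

lemma measurableSet_annulus (r R : ℝ) : MeasurableSet (annulus r R) :=
  (measurableSet_le measurable_const measurable_norm).inter
    (measurableSet_lt measurable_norm measurable_const)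

lemma annulus_zero (R : ℝ) : annulus 0 R = Metric.ball 0 R := by
  ext z; simp [annulus]

lemma integrableOn_annulus {f : ℂ → ℂ} (hf : Continuous f) (r R : ℝ) :
    IntegrableOn f (annulus r R) := by
  refine (hf.continuousOn.integrableOn_compact (isCompact_closedBall 0 R)).mono_set ?_
  intro z hz
  simpa using hz.2.le

lemma integral_annulus_norm_pow {r R : ℝ} (hr : 0 ≤ r) (hrR : r ≤ R) (j : ℕ) :
    ∫ z in annulus r R, ‖z‖ ^ (2 * j) =
      Real.pi * ((R ^ (2 * j + 2) - r ^ (2 * j + 2)) / (j + 1)) := by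
  have h1 : ∫ z in annulus r R, ‖z‖ ^ (2 * j) =
      ∫ z : ℂ, (Set.Ico r R).indicator (fun y : ℝ => y ^ (2 * j)) ‖z‖ := by
    rw [← integral_indicator (measurableSet_annulus r R)]
    rfl
  have h2 : ∫ y in Set.Ioi (0 : ℝ), y ^ (2 - 1) •
      (Set.Ico r R).indicator (fun y : ℝ => y ^ (2 * j)) y =
      ∫ y in r..R, y ^ (2 * j + 1) := by
    have : (fun y : ℝ => y ^ (2 - 1) • (Set.Ico r R).indicator (fun y : ℝ => y ^ (2 * j)) y) =
        (Set.Ico r R).indicator (fun y : ℝ => y ^ (2 * j + 1)) := by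
      ext y
      by_cases hy : y ∈ Set.Ico r R
      · simp [hy]; ring
      · simp [hy]
    rw [this, ← integral_Ici_eq_integral_Ioi, setIntegral_indicator measurableSet_Ico,
      intervalIntegral.integral_of_le hrR, ← integral_Ico_eq_integral_Ioc]
    congr 2
    ext y
    simp only [Set.mem_inter_iff, Set.mem_Ici, Set.mem_Ico]
    constructor
    · exact fun h => h.2
    · exact fun h => ⟨hr.trans h.1, h⟩
  rw [h1, integral_fun_norm_addHaar, Complex.finrank_real_complex, h2, integral_pow]
  have h3 : (volume : Measure ℂ).real (Metric.ball 0 1) = Real.pi := by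
    simp [Measure.real, Complex.volume_ball]
  rw [h3]
  simp only [nsmul_eq_mul, smul_eq_mul]
  push_cast
  have : (j : ℝ) + 1 ≠ 0 := by positivity
  have : (2 * (j : ℝ) + 1 + 1) ≠ 0 := by positivity
  field_simp
  ring

/-- Rotation by π/(j-k) preserves the annulus and area, and multiplies the integrand by -1. -/
lemma integral_annulus_mul_conj_eq_zero (r R : ℝ) {j k : ℕ} (hjk : j ≠ k) :
    ∫ z in annulus r R, z ^ j * (starRingEnd ℂ) (z ^ k) = 0 := by
  set c : Circle := Circle.exp (Real.pi / ((j : ℝ) - k)) with hc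
  have hd : (j : ℝ) - k ≠ 0 := sub_ne_zero.mpr (by exact_mod_cast hjk)
  have hcc : (c : ℂ) ^ j * (starRingEnd ℂ) ((c : ℂ) ^ k) = -1 := by
    rw [hc, Circle.coe_exp, map_pow, ← Complex.exp_conj, ← Complex.exp_nat_mul,
      ← Complex.exp_nat_mul, ← Complex.exp_add, ← Complex.exp_pi_mul_I]
    congr 1
    have hd' : (j : ℂ) - k ≠ 0 := by exact_mod_cast hd
    simp only [map_mul, Complex.conj_ofReal, Complex.conj_I]
    push_cast
    field_simp
    ring
  have hmp := (rotation c).measurePreserving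
  have h := hmp.setIntegral_preimage_emb (rotation c).toHomeomorph.measurableEmbedding
    (fun z => z ^ j * (starRingEnd ℂ) (z ^ k)) (annulus r R)
  have hpre : (rotation c) ⁻¹' annulus r R = annulus r R := by
    ext z
    simp only [annulus, Set.mem_preimage, Set.mem_ofPred_eq, LinearIsometryEquiv.norm_map]
  rw [hpre] at h
  have h2 : ∀ z : ℂ, (rotation c z) ^ j * (starRingEnd ℂ) ((rotation c z) ^ k) =
      -1 * (z ^ j * (starRingEnd ℂ) (z ^ k)) := by
    intro z
    rw [← hcc, rotation_apply, mul_pow, mul_pow, map_mul]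
    ring
  simp only [h2] at h
  rw [integral_const_mul] at h
  have : (2 : ℂ) * ∫ z in annulus r R, z ^ j * (starRingEnd ℂ) (z ^ k) = 0 := by
    linear_combination -h
  simpa using this

/-- Orthogonality of the monomials on annuli. -/
lemma integral_annulus_partialSum {r R : ℝ} (hr : 0 ≤ r) (hrR : r ≤ R) (a : ℕ → ℂ) (N : ℕ) :
    ∫ z in annulus r R, ‖partialSum a N z‖ ^ 2 = Real.pi *
      ∑ j ∈ Finset.range N, ‖a j‖ ^ 2 * ((R ^ (2 * j + 2) - r ^ (2 * j + 2)) / (j + 1)) := by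
  have hint : ∀ j k : ℕ, IntegrableOn (fun z : ℂ => a j * (starRingEnd ℂ) (a k) *
      (z ^ j * (starRingEnd ℂ) (z ^ k))) (annulus r R) := fun j k =>
    integrableOn_annulus (by fun_prop) r R
  have key : ((∫ z in annulus r R, ‖partialSum a N z‖ ^ 2 : ℝ) : ℂ) = ((Real.pi *
      ∑ j ∈ Finset.range N, ‖a j‖ ^ 2 *
        ((R ^ (2 * j + 2) - r ^ (2 * j + 2)) / (j + 1)) : ℝ) : ℂ) := by
    rw [← integral_complex_ofReal]
    have h1 : ∀ z : ℂ, ((‖partialSum a N z‖ ^ 2 : ℝ) : ℂ) = ∑ j ∈ Finset.range N,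
        ∑ k ∈ Finset.range N, a j * (starRingEnd ℂ) (a k) *
          (z ^ j * (starRingEnd ℂ) (z ^ k)) := by
      intro z
      rw [Complex.ofReal_pow, ← Complex.mul_conj', partialSum, map_sum, Finset.sum_mul_sum]
      refine Finset.sum_congr rfl fun j _ => Finset.sum_congr rfl fun k _ => ?_
      rw [map_mul]; ring
    simp only [h1]
    rw [integral_finsetSum _ fun j _ => integrable_finsetSum _ fun k _ => hint j k]
    push_cast
    rw [Finset.mul_sum]
    refine Finset.sum_congr rfl fun j hj => ?_
    rw [integral_finsetSum _ fun k _ => hint j k, Finset.sum_eq_single_of_mem j hj]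
    · rw [integral_const_mul, Complex.mul_conj']
      have h2 : ∀ z : ℂ, z ^ j * (starRingEnd ℂ) (z ^ j) = ((‖z‖ ^ (2 * j) : ℝ) : ℂ) := by
        intro z
        rw [Complex.mul_conj', norm_pow]; push_cast; ring
      simp only [h2]
      rw [integral_complex_ofReal, integral_annulus_norm_pow hr hrR]
      push_cast
      ring
    · intro k _ hk
      rw [integral_const_mul, integral_annulus_mul_conj_eq_zero r R (Ne.symm hk), mul_zero]
  exact_mod_cast key

lemma continuous_partialSum (a : ℕ → ℂ) (N : ℕ) : Continuous (partialSum a N) := by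
  unfold partialSum; fun_prop

/-! ### Bergman norm and mass estimates for polynomials -/

lemma disk_eq_annulus : disk = annulus 0 1 := (annulus_zero 1).symm

lemma mem_disk {z : ℂ} : z ∈ disk ↔ ‖z‖ < 1 := by simp [disk]

lemma normSq_partialSum (a : ℕ → ℂ) (N : ℕ) :
    normSq (partialSum a N) = ∑ j ∈ Finset.range N, ‖a j‖ ^ 2 / (j + 1) := by
  rw [normSq, disk_eq_annulus, integral_annulus_partialSum le_rfl zero_le_one, ← mul_assoc,
    one_div, inv_mul_cancel₀ Real.pi_ne_zero, one_mul]
  refine Finset.sum_congr rfl fun j _ => ?_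
  simp [div_eq_mul_inv]

lemma integrableOn_normSq_of_continuous {f : ℂ → ℂ} (hf : Continuous f) :
    IntegrableOn (fun z => ‖f z‖ ^ 2) disk :=
  ((hf.norm.pow 2).continuousOn.integrableOn_compact (isCompact_closedBall 0 1)).mono_set
    Metric.ball_subset_closedBall

lemma memBergman_of_differentiable {f : ℂ → ℂ} (hf : Differentiable ℂ f) : MemBergman f :=
  ⟨hf.differentiableOn, integrableOn_normSq_of_continuous hf.continuous⟩

lemma memBergman_partialSum (a : ℕ → ℂ) (N : ℕ) : MemBergman (partialSum a N) :=
  memBergman_of_differentiable (by unfold partialSum; fun_prop)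

lemma normSq_nonneg (f : ℂ → ℂ) : 0 ≤ normSq f :=
  mul_nonneg (by positivity) (integral_nonneg fun _ => by positivity)

lemma eval_eq_partialSum {p : Polynomial ℂ} {n : ℕ} (hp : p.natDegree ≤ n) :
    (fun z => p.eval z) = partialSum p.coeff (n + 1) := by
  ext z
  exact Polynomial.eval_eq_sum_range' (Nat.lt_succ_of_le hp) z

/-- The polynomial with the values `partialSum a N`. -/
def partialSumPoly (a : ℕ → ℂ) (N : ℕ) : Polynomial ℂ :=
  ∑ j ∈ Finset.range N, Polynomial.monomial j (a j)

lemma eval_partialSumPoly (a : ℕ → ℂ) (N : ℕ) :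
    (fun z => (partialSumPoly a N).eval z) = partialSum a N := by
  ext z
  simp [partialSumPoly, partialSum, Polynomial.eval_finsetSum]

lemma natDegree_partialSumPoly_le (a : ℕ → ℂ) (N : ℕ) :
    (partialSumPoly a (N + 1)).natDegree ≤ N := by
  refine Polynomial.natDegree_sum_le_of_forall_le _ _ fun j hj => ?_
  exact (Polynomial.natDegree_monomial_le _).trans (Nat.lt_succ_iff.mp (Finset.mem_range.mp hj))

/-- The sub-mean value property of `|p|²` on disks. -/
lemma norm_eval_sq_le_integral (p : Polynomial ℂ) (c : ℂ) {R : ℝ} (hR : 0 ≤ R) :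
    Real.pi * R ^ 2 * ‖p.eval c‖ ^ 2 ≤ ∫ z in Metric.ball c R, ‖p.eval z‖ ^ 2 := by
  set q := p.comp (Polynomial.X + Polynomial.C c) with hq
  have h1 : ∫ z in Metric.ball c R, ‖p.eval z‖ ^ 2 =
      ∫ z in Metric.ball (0 : ℂ) R, ‖q.eval z‖ ^ 2 := by
    have h := (measurePreserving_add_right (volume : Measure ℂ) c).setIntegral_preimage_emb
      (MeasurableEquiv.addRight c).measurableEmbedding (fun z => ‖p.eval z‖ ^ 2) (Metric.ball c R)
    rw [← h]
    have : (fun z : ℂ => z + c) ⁻¹' Metric.ball c R = Metric.ball 0 R := by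
      ext z; simp [dist_eq_norm]
    rw [this]
    simp [hq, Polynomial.eval_comp]
  have h2 : (fun z => ‖q.eval z‖ ^ 2) = fun z => ‖partialSum q.coeff (q.natDegree + 1) z‖ ^ 2 := by
    rw [← eval_eq_partialSum le_rfl]
  rw [h1, h2, ← annulus_zero, integral_annulus_partialSum le_rfl hR, mul_assoc]
  refine mul_le_mul_of_nonneg_left ?_ Real.pi_pos.le
  have h0 : q.coeff 0 = p.eval c := by
    rw [Polynomial.coeff_zero_eq_eval_zero]; simp [hq, Polynomial.eval_comp]
  -- Only the constant term of the orthogonal expansion about c is kept.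
  refine le_trans (le_of_eq ?_) (Finset.single_le_sum (f := fun j : ℕ => ‖q.coeff j‖ ^ 2 *
    ((R ^ (2 * j + 2) - 0 ^ (2 * j + 2)) / ((j : ℝ) + 1))) ?_
      (Finset.mem_range.mpr (Nat.succ_pos q.natDegree)))
  · simp [h0, mul_comm]
  · intro j _
    simp only [ne_eq, Nat.add_eq_zero_iff, OfNat.ofNat_ne_zero, and_false, not_false_eq_true,
      zero_pow, sub_zero]
    positivity

/-- Polynomials of degree at most `n` carry little mass in thin annuli at the boundary. -/
lemma integral_annulus_eval_le {p : Polynomial ℂ} {n : ℕ} (hp : p.natDegree ≤ n) {r : ℝ}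
    (hr : 0 ≤ r) (hr1 : r ≤ 1) :
    ∫ z in annulus r 1, ‖p.eval z‖ ^ 2 ≤
      Real.pi * ((2 * n + 2) * (1 - r)) * normSq (fun z => p.eval z) := by
  have h2 : (fun z => ‖p.eval z‖ ^ 2) = fun z => ‖partialSum p.coeff (n + 1) z‖ ^ 2 := by
    rw [← eval_eq_partialSum hp]
  rw [h2, eval_eq_partialSum hp, integral_annulus_partialSum hr hr1, normSq_partialSum, mul_assoc]
  refine mul_le_mul_of_nonneg_left ?_ Real.pi_pos.le
  rw [Finset.mul_sum]
  refine Finset.sum_le_sum fun j hj => ?_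
  have hjn : (j : ℝ) ≤ n := by exact_mod_cast Nat.lt_succ_iff.mp (Finset.mem_range.mp hj)
  -- Bernoulli's inequality at r = 1 + (r - 1).
  have hb := one_add_mul_le_pow (a := r - 1) (by linarith) (2 * j + 2)
  have hb' : 1 - r ^ (2 * j + 2) ≤ (2 * n + 2) * (1 - r) := by
    push_cast at hb
    have h3 : (2 * (j : ℝ) + 2) * (1 - r) ≤ (2 * n + 2) * (1 - r) := by gcongr
    have h4 : (1 + (r - 1)) = r := by ring
    rw [h4] at hb
    linarith
  calc ‖p.coeff j‖ ^ 2 * ((1 ^ (2 * j + 2) - r ^ (2 * j + 2)) / ((j : ℝ) + 1))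
      = (1 - r ^ (2 * j + 2)) * (‖p.coeff j‖ ^ 2 / ((j : ℝ) + 1)) := by rw [one_pow]; ring
    _ ≤ _ := by gcongr

/-! ### Comparison of the two kernels on the diagonal -/

/-- The diagonal `∑_{j ≤ n} (j+1) x^j` of the polynomial kernel, as a function of `x = |z|²`. -/
def diagKernel (n : ℕ) (x : ℝ) : ℝ := ∑ j ∈ Finset.range (n + 1), ((j : ℝ) + 1) * x ^ j

lemma kernel_self_re (z : ℂ) : (kernel z z).re = 1 / (1 - ‖z‖ ^ 2) ^ 2 := by
  rw [kernel, Complex.mul_conj']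
  norm_cast

lemma polyKernel_self_re (n : ℕ) (z : ℂ) : (polyKernel n z z).re = diagKernel n (‖z‖ ^ 2) := by
  rw [polyKernel, Complex.mul_conj', diagKernel, ← Complex.ofReal_re (Finset.sum _ _)]
  push_cast
  rfl

lemma samplingSum_kernel (Λ : Set ℂ) (f : ℂ → ℂ) : samplingSum kernel Λ f =
    ∑' z : Λ, ENNReal.ofReal (‖f z‖ ^ 2 * (1 - ‖(z : ℂ)‖ ^ 2) ^ 2) := by
  simp [samplingSum, kernel_self_re]

lemma samplingSum_polyKernel (n : ℕ) (Λ : Set ℂ) (f : ℂ → ℂ) : samplingSum (polyKernel n) Λ f =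
    ∑' z : Λ, ENNReal.ofReal (‖f z‖ ^ 2 / diagKernel n (‖(z : ℂ)‖ ^ 2)) := by
  simp [samplingSum, polyKernel_self_re]

lemma one_le_diagKernel (n : ℕ) {x : ℝ} (hx : 0 ≤ x) : 1 ≤ diagKernel n x := by
  refine le_trans (by simp) (Finset.single_le_sum (f := fun j : ℕ => ((j : ℝ) + 1) * x ^ j)
    (fun j _ => by positivity) (Finset.mem_range.mpr (Nat.succ_pos n)))

lemma hasSum_succ_mul_pow {𝕜 : Type*} [NormedField 𝕜] [CompleteSpace 𝕜] {x : 𝕜} (hx : ‖x‖ < 1) :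
    HasSum (fun j : ℕ => ((j : 𝕜) + 1) * x ^ j) (1 / (1 - x) ^ 2) := by
  have := hasSum_choose_mul_geometric_of_norm_lt_one 1 hx
  simpa using this

lemma diagKernel_mul_le_one (n : ℕ) {x : ℝ} (hx : 0 ≤ x) (hx1 : x < 1) :
    diagKernel n x * (1 - x) ^ 2 ≤ 1 := by
  have h := sum_le_hasSum (Finset.range (n + 1)) (fun j _ => by positivity)
    (hasSum_succ_mul_pow (x := x) (by rwa [Real.norm_of_nonneg hx]))
  have h1 : 0 < (1 - x) ^ 2 := by have : 0 < 1 - x := by linarith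
                                  positivity
  rwa [le_div_iff₀ h1] at h

/-- In the square of the geometric sum, x^k arises from at most k+1 pairs, and only for k ≤ 2m ≤ n.
This avoids a closed form of `diagKernel`. -/
lemma geom_sum_sq_le_diagKernel (m n : ℕ) (h : 2 * m ≤ n) {x : ℝ} (hx : 0 ≤ x) :
    (∑ i ∈ Finset.range (m + 1), x ^ i) ^ 2 ≤ diagKernel n x := by
  rw [sq, Finset.sum_mul_sum, ← Finset.sum_product',
    ← Finset.sum_fiberwise_of_maps_to (g := fun p : ℕ × ℕ => p.1 + p.2)
      (t := Finset.range (n + 1))]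
  · refine Finset.sum_le_sum fun k _ => ?_
    have hsub : {p ∈ Finset.range (m + 1) ×ˢ Finset.range (m + 1) | p.1 + p.2 = k} ⊆
        Finset.HasAntidiagonal.antidiagonal k := by
      intro p hp
      simpa using (Finset.mem_filter.mp hp).2
    calc _ = ∑ p ∈ Finset.range (m + 1) ×ˢ Finset.range (m + 1) with p.1 + p.2 = k, x ^ k := by
          refine Finset.sum_congr rfl fun p hp => ?_
          rw [← pow_add, (Finset.mem_filter.mp hp).2]
      _ ≤ ∑ p ∈ Finset.HasAntidiagonal.antidiagonal k, x ^ k :=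
          Finset.sum_le_sum_of_subset_of_nonneg hsub fun _ _ _ => by positivity
      _ = _ := by simp
  · intro p hp
    simp only [Finset.mem_product, Finset.mem_range] at hp ⊢
    lia

/-- The case m = ⌊n/2⌋ of the previous bound; the factor (1-x)² makes the geometric sum telescope.
-/
lemma sq_le_diagKernel_mul (n : ℕ) {x : ℝ} (hx : 0 ≤ x) :
    (1 - x ^ (n / 2 + 1)) ^ 2 ≤ diagKernel n x * (1 - x) ^ 2 := by
  have h := geom_sum_sq_le_diagKernel (n / 2) n (by lia) hx
  rw [← geom_sum_mul_neg, mul_pow]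
  gcongr

/-- Where `x^(n/2+1) ≤ q < 1`, the two kernels are comparable. -/
lemma div_diagKernel_le (n : ℕ) {x q a : ℝ} (hx : 0 ≤ x) (hq : x ^ (n / 2 + 1) ≤ q) (hq1 : q < 1)
    (ha : 0 ≤ a) : a / diagKernel n x ≤ ((1 - q) ^ 2)⁻¹ * (a * (1 - x) ^ 2) := by
  have h := sq_le_diagKernel_mul n hx
  have h0 : 0 < 1 - q := by linarith
  have h1 : (1 - q) ^ 2 ≤ diagKernel n x * (1 - x) ^ 2 := le_trans (by gcongr) h
  have hk : 0 < diagKernel n x := zero_lt_one.trans_le (one_le_diagKernel n hx)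
  rw [div_le_iff₀ hk, inv_mul_eq_div, div_mul_eq_mul_div, le_div_iff₀ (by positivity)]
  nlinarith [mul_le_mul_of_nonneg_left h1 ha]

lemma mul_le_div_diagKernel (n : ℕ) {x a : ℝ} (hx : 0 ≤ x) (hx1 : x < 1) (ha : 0 ≤ a) :
    a * (1 - x) ^ 2 ≤ a / diagKernel n x := by
  have hk : 0 < diagKernel n x := zero_lt_one.trans_le (one_le_diagKernel n hx)
  rw [le_div_iff₀ hk]
  nlinarith [mul_le_mul_of_nonneg_left (diagKernel_mul_le_one n hx hx1) ha]

/-- The coefficients of the polynomial `k_n(·, w)`. -/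
def kernelCoeff (w : ℂ) (j : ℕ) : ℂ := ((j : ℂ) + 1) * (starRingEnd ℂ) w ^ j

lemma polyKernel_eq_partialSum (n : ℕ) (w : ℂ) :
    (fun z => polyKernel n z w) = partialSum (kernelCoeff w) (n + 1) := by
  ext z
  refine Finset.sum_congr rfl fun j _ => ?_
  rw [kernelCoeff, mul_pow]; ring

lemma normSq_polyKernel (n : ℕ) (w : ℂ) :
    normSq (partialSum (kernelCoeff w) (n + 1)) = diagKernel n (‖w‖ ^ 2) := by
  rw [normSq_partialSum, diagKernel]
  refine Finset.sum_congr rfl fun j _ => ?_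
  have : ‖(j : ℂ) + 1‖ = (j : ℝ) + 1 := by
    rw [show (j : ℂ) + 1 = ((j + 1 : ℕ) : ℂ) by push_cast; rfl, Complex.norm_natCast]
    push_cast; rfl
  have h0 : (j : ℝ) + 1 ≠ 0 := by positivity
  rw [kernelCoeff, norm_mul, norm_pow, this, RCLike.norm_conj, ← pow_mul, mul_pow, ← pow_mul, mul_comm j 2]
  field_simp

lemma sq_mem {z : ℂ} (hz : z ∈ disk) : ‖z‖ ^ 2 < 1 := by
  have := mem_disk.mp hz
  nlinarith [norm_nonneg z]

/-! ### Taylor series and Parseval's identity -/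

lemma tendsto_partialSum {f : ℂ → ℂ} {a : ℕ → ℂ} {z : ℂ} (h : HasSum (fun j => a j * z ^ j) (f z)) :
    Tendsto (fun N => partialSum a N z) atTop (𝓝 (f z)) := h.tendsto_sum_nat

lemma exists_hasSum_of_differentiableOn {f : ℂ → ℂ} (hf : DifferentiableOn ℂ f disk) :
    ∃ a : ℕ → ℂ, ∀ z ∈ disk, HasSum (fun j => a j * z ^ j) (f z) := by
  refine ⟨fun j => (j.factorial : ℂ)⁻¹ * iteratedDeriv j f 0, fun z hz => ?_⟩
  have := Complex.hasSum_taylorSeries_on_ball hf hz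
  refine this.congr_fun fun j => ?_
  rw [sub_zero, smul_eq_mul, smul_eq_mul]; ring

/-- Fatou's lemma. -/
lemma normSq_le_of_tendsto {f : ℂ → ℂ} (hf : MemBergman f) {g : ℕ → ℂ → ℂ}
    (hg : ∀ N, Continuous (g N)) (hlim : ∀ z ∈ disk, Tendsto (fun N => g N z) atTop (𝓝 (f z)))
    {C : ℝ} (hC : ∀ N, normSq (g N) ≤ C) : normSq f ≤ C := by
  have hd : MeasurableSet disk := measurableSet_ball
  have h1 : ENNReal.ofReal (∫ z in disk, ‖f z‖ ^ 2) ≤ ENNReal.ofReal (Real.pi * C) := by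
    rw [ofReal_integral_eq_lintegral_ofReal hf.2 (ae_of_all _ fun _ => by positivity)]
    calc ∫⁻ z in disk, ENNReal.ofReal (‖f z‖ ^ 2)
        = ∫⁻ z in disk, liminf (fun N => ENNReal.ofReal (‖g N z‖ ^ 2)) atTop := by
          refine setLIntegral_congr_fun hd fun z hz => ?_
          refine (Tendsto.liminf_eq ?_).symm
          exact ENNReal.tendsto_ofReal (((hlim z hz).norm).pow 2)
      _ ≤ liminf (fun N => ∫⁻ z in disk, ENNReal.ofReal (‖g N z‖ ^ 2)) atTop :=
          lintegral_liminf_le fun N => by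
            have := hg N
            fun_prop
      _ ≤ ENNReal.ofReal (Real.pi * C) := by
          refine liminf_le_of_le (by isBoundedDefault) fun b hb => ?_
          obtain ⟨N, hN⟩ := hb.exists
          refine hN.trans ?_
          rw [← ofReal_integral_eq_lintegral_ofReal (integrableOn_normSq_of_continuous (hg N))
            (ae_of_all _ fun _ => by positivity)]
          refine ENNReal.ofReal_le_ofReal ?_
          have := hC N
          rwa [normSq, one_div, inv_mul_le_iff₀ Real.pi_pos] at this
  have hC0 : 0 ≤ C := (normSq_nonneg _).trans (hC 0)
  rw [ENNReal.ofReal_le_ofReal_iff (by have := Real.pi_pos; positivity)] at h1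
  rwa [normSq, one_div, inv_mul_le_iff₀ Real.pi_pos]

/-- Bessel's inequality for the monomials. -/
lemma sum_le_normSq {f : ℂ → ℂ} (hf : MemBergman f) {a : ℕ → ℂ}
    (ha : ∀ z ∈ disk, HasSum (fun j => a j * z ^ j) (f z)) (N : ℕ) :
    ∑ j ∈ Finset.range N, ‖a j‖ ^ 2 / (j + 1) ≤ normSq f := by
  -- On |z| < r the partial sums are uniformly dominated, so integrals converge; r → 1 comes at the
  -- end.
  have hr : ∀ r ∈ Set.Ioo (0 : ℝ) 1,
      ∑ j ∈ Finset.range N, ‖a j‖ ^ 2 * (r ^ (2 * j + 2) / (j + 1)) ≤ normSq f := by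
    intro r hr
    have hrd : (r : ℂ) ∈ disk := by
      rw [mem_disk, Complex.norm_real, Real.norm_of_nonneg hr.1.le]; exact hr.2
    have hs : Summable fun j => ‖a j‖ * r ^ j := by
      have := (ha r hrd).summable.norm
      simpa [abs_of_pos hr.1] using this
    have hsub : annulus 0 r ⊆ disk := by
      intro z hz; rw [mem_disk]; exact hz.2.trans hr.2
    have hlim : Tendsto (fun M => ∫ z in annulus 0 r, ‖partialSum a M z‖ ^ 2) atTop
        (𝓝 (∫ z in annulus 0 r, ‖f z‖ ^ 2)) := by
      refine tendsto_integral_of_dominated_convergence (fun _ => (∑' j, ‖a j‖ * r ^ j) ^ 2)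
        (fun M => ((continuous_partialSum a M).norm.pow 2).aestronglyMeasurable) ?_ ?_ ?_
      · refine integrableOn_const ?_
        rw [annulus_zero]
        exact measure_ball_lt_top.ne
      · intro M
        refine (ae_restrict_iff' (measurableSet_annulus 0 r)).mpr (ae_of_all _ fun z hz => ?_)
        rw [Real.norm_of_nonneg (by positivity)]
        refine pow_le_pow_left₀ (norm_nonneg _) ?_ 2
        calc ‖partialSum a M z‖ ≤ ∑ j ∈ Finset.range M, ‖a j‖ * r ^ j := by
              refine (norm_sum_le _ _).trans (Finset.sum_le_sum fun j _ => ?_)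
              rw [norm_mul, norm_pow]
              gcongr
              exact hz.2.le
          _ ≤ _ := hs.sum_le_tsum _ fun j _ => mul_nonneg (norm_nonneg _) (pow_nonneg hr.1.le _)
      · refine (ae_restrict_iff' (measurableSet_annulus 0 r)).mpr (ae_of_all _ fun z hz => ?_)
        exact (tendsto_partialSum (ha z (hsub hz))).norm.pow 2
    have hge : Real.pi * ∑ j ∈ Finset.range N, ‖a j‖ ^ 2 * (r ^ (2 * j + 2) / (j + 1)) ≤
        ∫ z in annulus 0 r, ‖f z‖ ^ 2 := by
      refine ge_of_tendsto hlim ((eventually_ge_atTop N).mono fun M hM => ?_)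
      rw [integral_annulus_partialSum le_rfl hr.1.le]
      simp only [ne_eq, Nat.add_eq_zero_iff, OfNat.ofNat_ne_zero, and_false, not_false_eq_true,
        zero_pow, sub_zero]
      refine mul_le_mul_of_nonneg_left ?_ Real.pi_pos.le
      refine Finset.sum_le_sum_of_subset_of_nonneg (Finset.range_mono hM) fun j _ _ => ?_
      have := hr.1
      positivity
    rw [normSq, one_div, le_inv_mul_iff₀ Real.pi_pos]
    exact hge.trans (setIntegral_mono_set hf.2 (ae_of_all _ fun _ => by positivity)
      (LE.le.eventuallyLE hsub))
  have hc : Continuous fun r : ℝ =>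
      ∑ j ∈ Finset.range N, ‖a j‖ ^ 2 * (r ^ (2 * j + 2) / ((j : ℝ) + 1)) := by fun_prop
  have ht := (hc.tendsto 1).mono_left (nhdsWithin_le_nhds (s := Set.Iio 1))
  have h := le_of_tendsto ht (mem_of_superset (Ioo_mem_nhdsLT zero_lt_one) hr)
  simpa [div_eq_mul_inv] using h

/-- Parseval's identity in the Bergman space. -/
lemma hasSum_normSq {f : ℂ → ℂ} (hf : MemBergman f) {a : ℕ → ℂ}
    (ha : ∀ z ∈ disk, HasSum (fun j => a j * z ^ j) (f z)) :
    HasSum (fun j : ℕ => ‖a j‖ ^ 2 / ((j : ℝ) + 1)) (normSq f) := by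
  have h0 : ∀ j : ℕ, 0 ≤ ‖a j‖ ^ 2 / ((j : ℝ) + 1) := fun j => by positivity
  have hs := summable_of_sum_range_le h0 (sum_le_normSq hf ha)
  have h1 := Real.tsum_le_of_sum_range_le h0 (sum_le_normSq hf ha)
  have h2 : normSq f ≤ ∑' j : ℕ, ‖a j‖ ^ 2 / ((j : ℝ) + 1) :=
    normSq_le_of_tendsto hf (continuous_partialSum a) (fun z hz => tendsto_partialSum (ha z hz))
      fun N => by
        rw [normSq_partialSum]
        exact hs.sum_le_tsum _ fun j _ => h0 j
  rw [le_antisymm h2 h1]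
  exact hs.hasSum

lemma MemBergman.sub {f g : ℂ → ℂ} (hf : MemBergman f) (hg : MemBergman g) :
    MemBergman (fun z => f z - g z) := by
  have hd := hf.1.sub hg.1
  refine ⟨hd, ?_⟩
  refine Integrable.mono' ((hf.2.const_mul 2).add (hg.2.const_mul 2))
    ((hd.continuousOn.norm.pow 2).aestronglyMeasurable measurableSet_ball)
    (ae_of_all _ fun z => ?_)
  rw [Real.norm_of_nonneg (by positivity)]
  have := norm_sub_le (f z) (g z)
  simp only [Pi.add_apply]
  nlinarith [sq_nonneg (‖f z‖ - ‖g z‖), norm_nonneg (f z - g z)]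

/-- The Taylor polynomials converge in the Bergman space. -/
lemma tendsto_normSq_sub_partialSum {f : ℂ → ℂ} (hf : MemBergman f) {a : ℕ → ℂ}
    (ha : ∀ z ∈ disk, HasSum (fun j => a j * z ^ j) (f z)) :
    Tendsto (fun N => normSq (fun z => f z - partialSum a N z)) atTop (𝓝 0) := by
  -- Parseval for the remainder, whose Taylor coefficients are those of f with the first N set to 0.
  have h : ∀ N, normSq (fun z => f z - partialSum a N z) =
      normSq f - ∑ j ∈ Finset.range N, ‖a j‖ ^ 2 / ((j : ℝ) + 1) := by
    intro N
    have hb : ∀ z ∈ disk, HasSum (fun j => (if j ∈ Finset.range N then 0 else a j) * z ^ j)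
        (f z - partialSum a N z) := by
      intro z hz
      have h1 := (ha z hz).sub (hasSum_sum_of_ne_finset_zero (s := Finset.range N)
        (f := fun j => if j ∈ Finset.range N then a j * z ^ j else 0)
        (fun j hj => by simp only [hj, if_false]))
      have h2 : ∑ j ∈ Finset.range N, (if j ∈ Finset.range N then a j * z ^ j else 0) =
          partialSum a N z := Finset.sum_congr rfl fun j hj => by simp only [hj, if_true]
      rw [h2] at h1
      refine h1.congr_fun fun j => ?_
      split_ifs <;> simp
    have h1 := hasSum_normSq (hf.sub (memBergman_partialSum a N)) hb
    have h2 := (hasSum_normSq hf ha).sub (hasSum_sum_of_ne_finset_zero (s := Finset.range N)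
        (f := fun j => if j ∈ Finset.range N then ‖a j‖ ^ 2 / ((j : ℝ) + 1) else 0)
        (fun j hj => by simp only [hj, if_false]))
    have h3 : ∑ j ∈ Finset.range N,
        (if j ∈ Finset.range N then ‖a j‖ ^ 2 / ((j : ℝ) + 1) else 0) =
          ∑ j ∈ Finset.range N, ‖a j‖ ^ 2 / ((j : ℝ) + 1) :=
      Finset.sum_congr rfl fun j hj => by simp only [hj, if_true]
    rw [h3] at h2
    refine h1.unique (h2.congr_fun fun j => ?_)
    split_ifs <;> simp
  simp only [h]
  simpa using (tendsto_const_nhds (x := normSq f)).sub (hasSum_normSq hf ha).tendsto_sum_nat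

/-! ### Sampling sums through finite subsets, and the kernel at close points -/

lemma tsum_ofReal_le_iff {Λ : Set ℂ} {g : ℂ → ℝ} (hg : ∀ z, 0 ≤ g z) {C : ℝ} (hC : 0 ≤ C) :
    ∑' z : Λ, ENNReal.ofReal (g z) ≤ ENNReal.ofReal C ↔
      ∀ F : Finset ℂ, (F : Set ℂ) ⊆ Λ → ∑ z ∈ F, g z ≤ C := by
  constructor
  · intro h F hF
    have h1 : ∑' z : (F : Set ℂ), ENNReal.ofReal (g z) ≤ ENNReal.ofReal C :=
      (ENNReal.tsum_mono_subtype (fun z => ENNReal.ofReal (g z)) hF).trans h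
    rw [Finset.tsum_subtype' F (fun z => ENNReal.ofReal (g z)),
      ← ENNReal.ofReal_sum_of_nonneg fun z _ => hg z] at h1
    exact (ENNReal.ofReal_le_ofReal_iff hC).mp h1
  · intro h
    rw [ENNReal.tsum_eq_iSup_sum]
    refine iSup_le fun s => ?_
    have h1 := h (s.map (Function.Embedding.subtype _)) (by intro z; simp +contextual)
    rw [Finset.sum_map] at h1
    rw [← ENNReal.ofReal_sum_of_nonneg fun (z : Λ) _ => hg z]
    exact ENNReal.ofReal_le_ofReal h1

lemma samplingSum_kernel_le_iff {Λ : Set ℂ} {f : ℂ → ℂ} {C : ℝ} (hC : 0 ≤ C) :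
    samplingSum kernel Λ f ≤ ENNReal.ofReal C ↔ ∀ F : Finset ℂ, (F : Set ℂ) ⊆ Λ →
      ∑ z ∈ F, ‖f z‖ ^ 2 * (1 - ‖z‖ ^ 2) ^ 2 ≤ C := by
  rw [samplingSum_kernel]
  exact tsum_ofReal_le_iff (g := fun z => ‖f z‖ ^ 2 * (1 - ‖z‖ ^ 2) ^ 2)
    (fun z => by positivity) hC

lemma diagKernel_pos (n : ℕ) {x : ℝ} (hx : 0 ≤ x) : 0 < diagKernel n x :=
  zero_lt_one.trans_le (one_le_diagKernel n hx)

lemma div_diagKernel_nonneg (n : ℕ) (f : ℂ → ℂ) (z : ℂ) :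
    0 ≤ ‖f z‖ ^ 2 / diagKernel n (‖z‖ ^ 2) :=
  div_nonneg (by positivity) (diagKernel_pos n (by positivity)).le

lemma samplingSum_polyKernel_le_iff {n : ℕ} {Λ : Set ℂ} {f : ℂ → ℂ} {C : ℝ} (hC : 0 ≤ C) :
    samplingSum (polyKernel n) Λ f ≤ ENNReal.ofReal C ↔ ∀ F : Finset ℂ, (F : Set ℂ) ⊆ Λ →
      ∑ z ∈ F, ‖f z‖ ^ 2 / diagKernel n (‖z‖ ^ 2) ≤ C := by
  rw [samplingSum_polyKernel]
  exact tsum_ofReal_le_iff (g := fun z => ‖f z‖ ^ 2 / diagKernel n (‖z‖ ^ 2))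
    (div_diagKernel_nonneg n f) hC

lemma memBergman_eval (p : Polynomial ℂ) : MemBergman (fun z => p.eval z) :=
  memBergman_of_differentiable p.differentiable

lemma tendsto_polyKernel {z w : ℂ} (hz : z ∈ disk) (hw : w ∈ disk) :
    Tendsto (fun n => polyKernel n z w) atTop (𝓝 (kernel z w)) := by
  have hlt : ‖z * (starRingEnd ℂ) w‖ < 1 := by
    rw [norm_mul, RCLike.norm_conj]
    have := mem_disk.mp hz
    have := mem_disk.mp hw
    nlinarith [norm_nonneg z, norm_nonneg w]
  exact (hasSum_succ_mul_pow hlt).tendsto_sum_nat.comp (tendsto_add_atTop_nat 1)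

/-- Off-diagonal lower bound of the normalized kernel at hyperbolically close points. -/
lemma one_le_kernel_of_close {l z : ℂ} (hl : l ∈ disk) (hz : z ∈ disk)
    (hlz : ‖l - z‖ ≤ (1 - ‖l‖) / 2) :
    1 ≤ 9 * (‖kernel l z‖ ^ 2 * (1 - ‖l‖ ^ 2) ^ 2 * (1 - ‖z‖ ^ 2) ^ 2) := by
  rw [mem_disk] at hl hz
  have hl0 := norm_nonneg l
  have hz0 := norm_nonneg z
  set t := ‖1 - l * (starRingEnd ℂ) z‖ with ht
  -- Closeness gives |l-z| ≤ (1-|l|²)/2 and, as 1-|l| ≥ 2|l-z|, also |l-z| ≤ 1-|z|. Hence the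
  -- factors 3/2 and 2; the square of their product is the 9.
  have h1 : t ≤ 3 / 2 * (1 - ‖l‖ ^ 2) := by
    have : (1 : ℂ) - l * (starRingEnd ℂ) z =
        ((1 - ‖l‖ ^ 2 : ℝ) : ℂ) + l * (starRingEnd ℂ) (l - z) := by
      rw [map_sub, mul_sub, Complex.mul_conj']; push_cast; ring
    rw [ht, this]
    refine (norm_add_le _ _).trans ?_
    rw [norm_mul, RCLike.norm_conj, Complex.norm_real, Real.norm_of_nonneg (by nlinarith)]
    nlinarith [norm_nonneg (l - z)]
  have h2 : t ≤ 2 * (1 - ‖z‖ ^ 2) := by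
    have : (1 : ℂ) - l * (starRingEnd ℂ) z =
        ((1 - ‖z‖ ^ 2 : ℝ) : ℂ) - (l - z) * (starRingEnd ℂ) z := by
      rw [sub_mul, Complex.mul_conj']; push_cast; ring
    have h3 : ‖z‖ ≤ ‖l‖ + ‖l - z‖ := by
      have := norm_sub_le l (l - z)
      simpa using this
    rw [ht, this]
    refine (norm_sub_le _ _).trans ?_
    rw [norm_mul, RCLike.norm_conj, Complex.norm_real, Real.norm_of_nonneg (by nlinarith)]
    nlinarith [norm_nonneg (l - z)]
  have ht0 : 0 < t := by
    rw [ht, norm_pos_iff]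
    intro h
    have : ‖l * (starRingEnd ℂ) z‖ = 1 := by rw [← sub_eq_zero.mp h, norm_one]
    rw [norm_mul, RCLike.norm_conj] at this
    nlinarith
  have h3 : t ^ 2 ≤ 3 * ((1 - ‖l‖ ^ 2) * (1 - ‖z‖ ^ 2)) := by
    calc t ^ 2 = t * t := sq t
      _ ≤ (3 / 2 * (1 - ‖l‖ ^ 2)) * (2 * (1 - ‖z‖ ^ 2)) := mul_le_mul h1 h2 ht0.le (ht0.le.trans h1)
      _ = _ := by ring
  have h4 : ‖kernel l z‖ = 1 / t ^ 2 := by rw [kernel, norm_div, norm_one, norm_pow]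
  have h5 : (t ^ 2) ^ 2 ≤ (3 * ((1 - ‖l‖ ^ 2) * (1 - ‖z‖ ^ 2))) ^ 2 := by gcongr
  rw [h4, show 9 * ((1 / t ^ 2) ^ 2 * (1 - ‖l‖ ^ 2) ^ 2 * (1 - ‖z‖ ^ 2) ^ 2) =
    (3 * ((1 - ‖l‖ ^ 2) * (1 - ‖z‖ ^ 2))) ^ 2 / (t ^ 2) ^ 2 by ring, le_div_iff₀ (by positivity)]
  linarith

/-! ### Part (i): truncations of sampling sets -/

section Truncation

variable {Λ : Set ℂ} {B : ℝ}

/-- The upper sampling bound limits the number of hyperbolically close points. -/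
lemma card_le_of_close (hΛ : Λ ⊆ disk) (hB : 0 ≤ B)
    (h : ∀ p : Polynomial ℂ, samplingSum kernel Λ (fun z => p.eval z) ≤
      ENNReal.ofReal (B * normSq (fun z => p.eval z)))
    {z : ℂ} (hz : z ∈ disk) {F : Finset ℂ} (hF : (F : Set ℂ) ⊆ Λ)
    (hclose : ∀ l ∈ F, ‖l - z‖ ≤ (1 - ‖l‖) / 2) : (F.card : ℝ) ≤ 9 * B := by
  have hpos : 0 < (1 - ‖z‖ ^ 2) ^ 2 := by
    have := sq_mem hz
    have : 0 < 1 - ‖z‖ ^ 2 := by linarith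
    positivity
  -- The test function is k_n(·,z), a polynomial of squared norm k_n(z,z) ≤ (1-|z|²)⁻²; then n → ∞
  -- replaces k_n by k.
  have h1 : ∀ n, (∑ l ∈ F, ‖polyKernel n l z‖ ^ 2 * (1 - ‖l‖ ^ 2) ^ 2) * (1 - ‖z‖ ^ 2) ^ 2 ≤ B := by
    intro n
    have h2 := h (partialSumPoly (kernelCoeff z) (n + 1))
    rw [eval_partialSumPoly, ← polyKernel_eq_partialSum,
      samplingSum_kernel_le_iff (mul_nonneg hB (normSq_nonneg _)), polyKernel_eq_partialSum,
      normSq_polyKernel] at h2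
    have h3 := h2 F hF
    have h4 := diagKernel_mul_le_one n (x := ‖z‖ ^ 2) (by positivity) (sq_mem hz)
    calc _ ≤ (B * diagKernel n (‖z‖ ^ 2)) * (1 - ‖z‖ ^ 2) ^ 2 := by gcongr
      _ = B * (diagKernel n (‖z‖ ^ 2) * (1 - ‖z‖ ^ 2) ^ 2) := by ring
      _ ≤ B * 1 := by gcongr
      _ = B := mul_one B
  have h2 : (∑ l ∈ F, ‖kernel l z‖ ^ 2 * (1 - ‖l‖ ^ 2) ^ 2) * (1 - ‖z‖ ^ 2) ^ 2 ≤ B := by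
    refine le_of_tendsto' (f := fun n => (∑ l ∈ F, ‖polyKernel n l z‖ ^ 2 * (1 - ‖l‖ ^ 2) ^ 2) *
      (1 - ‖z‖ ^ 2) ^ 2) (x := atTop)
      (Tendsto.mul_const _ (tendsto_finsetSum _ fun l hl => ?_)) h1
    exact (((tendsto_polyKernel (hΛ (hF hl)) hz).norm).pow 2).mul_const _
  calc (F.card : ℝ) = ∑ l ∈ F, (1 : ℝ) := by simp
    _ ≤ ∑ l ∈ F, 9 * (‖kernel l z‖ ^ 2 * (1 - ‖l‖ ^ 2) ^ 2 * (1 - ‖z‖ ^ 2) ^ 2) :=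
        Finset.sum_le_sum fun l hl =>
          one_le_kernel_of_close (hΛ (hF hl)) hz (hclose l hl)
    _ = 9 * ((∑ l ∈ F, ‖kernel l z‖ ^ 2 * (1 - ‖l‖ ^ 2) ^ 2) * (1 - ‖z‖ ^ 2) ^ 2) := by
        rw [← Finset.mul_sum, Finset.sum_mul]
    _ ≤ 9 * B := by gcongr

/-- A Carleson-type bound for the part of `Λ` close to the boundary. -/
lemma sum_near_boundary_le (hΛ : Λ ⊆ disk) (hB : 0 ≤ B)
    (h : ∀ p : Polynomial ℂ, samplingSum kernel Λ (fun z => p.eval z) ≤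
      ENNReal.ofReal (B * normSq (fun z => p.eval z)))
    (p : Polynomial ℂ) {δ : ℝ} {F : Finset ℂ} (hF : (F : Set ℂ) ⊆ Λ)
    (hFδ : ∀ l ∈ F, 1 - δ ≤ ‖l‖) :
    ∑ l ∈ F, ‖p.eval l‖ ^ 2 * (1 - ‖l‖ ^ 2) ^ 2 ≤
      144 * B / Real.pi * ∫ z in annulus (1 - 2 * δ) 1, ‖p.eval z‖ ^ 2 := by
  have hpi := Real.pi_pos
  have hint : ∀ s : Set ℂ, s ⊆ disk → IntegrableOn (fun z => ‖p.eval z‖ ^ 2) s := fun s hs =>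
    (memBergman_eval p).2.mono_set hs
  have hball : ∀ l ∈ F, Metric.ball l ((1 - ‖l‖) / 2) ⊆ annulus (1 - 2 * δ) 1 := by
    intro l hl z hz
    rw [Metric.mem_ball, dist_eq_norm] at hz
    have h1 := mem_disk.mp (hΛ (hF hl))
    have h2 := hFδ l hl
    have h3 : ‖z‖ ≤ ‖l‖ + ‖z - l‖ := by simpa using norm_add_le l (z - l)
    have h4 : ‖l‖ ≤ ‖z‖ + ‖z - l‖ := by simpa using norm_sub_le z (z - l)
    constructor <;> linarith
  have hann : annulus (1 - 2 * δ) 1 ⊆ disk := fun z hz => mem_disk.mpr hz.2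
  -- The quantity 1-|l|² is at most four times the radius (1-|l|)/2, so the sub-mean value property
  -- gives 16/π.
  have hone : ∀ l ∈ F, ‖p.eval l‖ ^ 2 * (1 - ‖l‖ ^ 2) ^ 2 ≤
      16 / Real.pi * ∫ z in Metric.ball l ((1 - ‖l‖) / 2), ‖p.eval z‖ ^ 2 := by
    intro l hl
    have h1 := mem_disk.mp (hΛ (hF hl))
    have h2 := norm_eval_sq_le_integral p l (R := (1 - ‖l‖) / 2) (by linarith)
    have h3 : (1 - ‖l‖ ^ 2) ^ 2 ≤ (2 * (1 - ‖l‖)) ^ 2 :=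
      pow_le_pow_left₀ (by nlinarith [norm_nonneg l]) (by nlinarith [norm_nonneg l]) 2
    calc ‖p.eval l‖ ^ 2 * (1 - ‖l‖ ^ 2) ^ 2 ≤ ‖p.eval l‖ ^ 2 * (2 * (1 - ‖l‖)) ^ 2 := by gcongr
      _ = 16 / Real.pi * (Real.pi * ((1 - ‖l‖) / 2) ^ 2 * ‖p.eval l‖ ^ 2) := by
          field_simp; ring
      _ ≤ _ := by gcongr
  -- By `card_le_of_close`, each z lies in at most 9B of the balls.
  have hover : ∑ l ∈ F, ∫ z in Metric.ball l ((1 - ‖l‖) / 2), ‖p.eval z‖ ^ 2 ≤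
      9 * B * ∫ z in annulus (1 - 2 * δ) 1, ‖p.eval z‖ ^ 2 := by
    have hi : ∀ l ∈ F, Integrable
        ((Metric.ball l ((1 - ‖l‖) / 2)).indicator fun z => ‖p.eval z‖ ^ 2) := fun l hl =>
      (hint _ ((hball l hl).trans hann)).integrable_indicator measurableSet_ball
    have he : ∀ l ∈ F, ∫ z in Metric.ball l ((1 - ‖l‖) / 2), ‖p.eval z‖ ^ 2 =
        ∫ z, (Metric.ball l ((1 - ‖l‖) / 2)).indicator (fun z => ‖p.eval z‖ ^ 2) z :=
      fun l _ => (integral_indicator measurableSet_ball).symm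
    rw [Finset.sum_congr rfl he, ← integral_finsetSum _ hi, ← integral_const_mul,
      ← integral_indicator (measurableSet_annulus _ _)]
    refine integral_mono (integrable_finsetSum _ hi)
      (IntegrableOn.integrable_indicator ((hint _ hann).const_mul _) (measurableSet_annulus _ _)) fun z => ?_
    by_cases hz : z ∈ annulus (1 - 2 * δ) 1
    · simp only [Set.indicator_of_mem hz]
      classical
      simp only [Set.indicator_apply]
      rw [← Finset.sum_filter, Finset.sum_const, nsmul_eq_mul]
      refine mul_le_mul_of_nonneg_right ?_ (by positivity)
      refine card_le_of_close hΛ hB h (hann hz) (F := F.filter _)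
        (fun l hl => hF (Finset.mem_filter.mp hl).1) fun l hl => ?_
      have := (Finset.mem_filter.mp hl).2
      rw [Metric.mem_ball, dist_comm, dist_eq_norm] at this
      exact this.le
    · rw [Set.indicator_of_notMem hz]
      refine (Finset.sum_eq_zero fun l hl => ?_).le
      exact Set.indicator_of_notMem (fun hzl => hz (hball l hl hzl)) _
  calc ∑ l ∈ F, ‖p.eval l‖ ^ 2 * (1 - ‖l‖ ^ 2) ^ 2
      ≤ 16 / Real.pi * ∑ l ∈ F, ∫ z in Metric.ball l ((1 - ‖l‖) / 2), ‖p.eval z‖ ^ 2 := by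
        rw [Finset.mul_sum]; exact Finset.sum_le_sum hone
    _ ≤ 16 / Real.pi * (9 * B * ∫ z in annulus (1 - 2 * δ) 1, ‖p.eval z‖ ^ 2) := by gcongr
    _ = _ := by ring

/-- The width 2γ/n of the annulus cancels the factor n in its mass bound, so the loss is O(γ)
uniformly in n. The condition γ ≤ 1/2 keeps the inner radius nonnegative. -/
lemma sum_near_boundary_le_normSq (hΛ : Λ ⊆ disk) (hB : 0 ≤ B)
    (h : ∀ p : Polynomial ℂ, samplingSum kernel Λ (fun z => p.eval z) ≤
      ENNReal.ofReal (B * normSq (fun z => p.eval z)))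
    {p : Polynomial ℂ} {n : ℕ} (hn : 1 ≤ n) (hp : p.natDegree ≤ n) {γ : ℝ} (hγ : 0 < γ)
    (hγ1 : γ ≤ 1 / 2) :
    samplingSum kernel (Λ ∩ {z | 1 - γ / n ≤ ‖z‖}) (fun z => p.eval z) ≤
      ENNReal.ofReal (1152 * B * γ * normSq (fun z => p.eval z)) := by
  have hn' : (1 : ℝ) ≤ n := by exact_mod_cast hn
  have hN := normSq_nonneg (fun z => p.eval z)
  have hpi := Real.pi_pos
  have hd : γ / n ≤ 1 / 2 := (div_le_self hγ.le hn').trans hγ1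
  have hd0 : 0 < γ / n := by positivity
  rw [samplingSum_kernel_le_iff (by positivity)]
  intro F hF
  refine (sum_near_boundary_le hΛ hB h p (fun l hl => (hF hl).1) fun l hl => (hF hl).2).trans ?_
  have h1 := integral_annulus_eval_le hp (r := 1 - 2 * (γ / n)) (by linarith) (by linarith)
  have h2 : (2 * (n : ℝ) + 2) * (1 - (1 - 2 * (γ / n))) ≤ 8 * γ := by
    have : (2 * (n : ℝ) + 2) * (1 - (1 - 2 * (γ / n))) = 4 * γ + 4 * (γ / n) := by
      field_simp; ring
    have := div_le_self hγ.le hn'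
    linarith
  calc _ ≤ 144 * B / Real.pi * (Real.pi * ((2 * n + 2) * (1 - (1 - 2 * (γ / n)))) *
          normSq (fun z => p.eval z)) := by gcongr
    _ ≤ 144 * B / Real.pi * (Real.pi * (8 * γ) * normSq (fun z => p.eval z)) := by gcongr
    _ = _ := by field_simp; ring

lemma finite_of_card_le {α : Type*} {s : Set α} {C : ℝ}
    (h : ∀ F : Finset α, (F : Set α) ⊆ s → (F.card : ℝ) ≤ C) : s.Finite := by
  by_contra hs
  obtain ⟨N, hN⟩ := exists_nat_gt C
  obtain ⟨F, hF, hc⟩ := Set.Infinite.exists_subset_card_eq hs N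
  have := h F hF
  rw [hc] at this
  linarith

/-- Tested on the constant 1, each point contributes at least (1-r)². -/
lemma finite_inter_of_norm_le (hB : 0 ≤ B)
    (h : ∀ p : Polynomial ℂ, samplingSum kernel Λ (fun z => p.eval z) ≤
      ENNReal.ofReal (B * normSq (fun z => p.eval z))) {r : ℝ} (hr : r < 1) :
    (Λ ∩ {z | ‖z‖ ≤ r}).Finite := by
  have h1 := (samplingSum_kernel_le_iff (mul_nonneg hB (normSq_nonneg _))).mp (h 1)
  refine finite_of_card_le (C := ((1 - r) ^ 2)⁻¹ * (B * normSq fun z => (1 : Polynomial ℂ).eval z))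
    fun F hF => ?_
  have h2 := h1 F fun l hl => (hF hl).1
  have h0 : 0 < 1 - r := by linarith
  rw [le_inv_mul_iff₀ (by positivity)]
  refine le_trans ?_ h2
  rw [mul_comm, ← nsmul_eq_mul, ← Finset.sum_const]
  refine Finset.sum_le_sum fun l hl => ?_
  have hl' : ‖l‖ ≤ r := (hF hl).2
  rw [Polynomial.eval_one, norm_one, one_pow, one_mul]
  exact pow_le_pow_left₀ h0.le (by nlinarith [norm_nonneg l]) 2

/-- Truncations of sampling sets are Marcinkiewicz–Zygmund families. -/
theorem IsSampling.exists_isMZFamily (hS : IsSampling Λ) :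
    ∃ γ₀ : ℝ, 0 < γ₀ ∧ ∀ γ : ℝ, 0 < γ → γ < γ₀ →
      IsMZFamily (fun n : ℕ => Λ ∩ {z : ℂ | ‖z‖ < 1 - γ / (n : ℝ)}) := by
  obtain ⟨hΛ, A, B, hA, hB, hAB⟩ := hS
  have hup : ∀ p : Polynomial ℂ, samplingSum kernel Λ (fun z => p.eval z) ≤
      ENNReal.ofReal (B * normSq (fun z => p.eval z)) := fun p => (hAB _ (memBergman_eval p)).2
  -- The second bound on γ makes the boundary loss at most half of the lower constant A.
  refine ⟨min (1 / 2) (A / (2 * (1152 * B))), by positivity, fun γ hγ hγ0 => ?_⟩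
  have hγ1 : γ ≤ 1 / 2 := (hγ0.trans_le (min_le_left _ _)).le
  have hγ2 : 1152 * B * γ ≤ A / 2 := by
    have := (hγ0.trans_le (min_le_right _ _)).le
    rw [le_div_iff₀ (by positivity)] at this
    linarith
  -- For |z| < 1 - γ/n one has |z|² ≤ e^(-γ/n), so its power n/2+1 is at most q, whatever n is.
  set q := Real.exp (-(γ / 2)) with hq
  have hq1 : q < 1 := by rw [hq, Real.exp_lt_one_iff]; linarith
  have hc : 0 < ((1 - q) ^ 2)⁻¹ := by
    have : 0 < 1 - q := by linarith
    positivity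
  -- The threshold n₀ = 1 skips n = 0, where γ / 0 = 0 and nothing is truncated.
  refine ⟨fun n z hz => hΛ hz.1, A / 2, ((1 - q) ^ 2)⁻¹ * B, by positivity, by positivity, 1,
    fun n hn => ⟨?_, fun p hp => ⟨?_, ?_⟩⟩⟩
  · have hn' : (0 : ℝ) < n := by exact_mod_cast hn
    have hr : 1 - γ / n < 1 := by have : 0 < γ / n := by positivity
                                  linarith
    exact (finite_inter_of_norm_le hB.le hup hr).subset fun z hz =>
      ⟨hz.1, le_of_lt (show ‖z‖ < 1 - γ / n from hz.2)⟩
  · have hN := normSq_nonneg (fun z => p.eval z)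
    have hlow := (hAB _ (memBergman_eval p)).1
    have htail := sum_near_boundary_le_normSq hΛ hB.le hup hn hp hγ hγ1
    have hsplit : samplingSum kernel Λ (fun z => p.eval z) ≤
        samplingSum kernel (Λ ∩ {z | ‖z‖ < 1 - γ / n}) (fun z => p.eval z) +
          samplingSum kernel (Λ ∩ {z | 1 - γ / n ≤ ‖z‖}) (fun z => p.eval z) := by
      refine (ENNReal.tsum_mono_subtype
        (fun z => ENNReal.ofReal (‖p.eval z‖ ^ 2 / (kernel z z).re)) ?_).trans
        (ENNReal.tsum_union_le
          (fun z => ENNReal.ofReal (‖p.eval z‖ ^ 2 / (kernel z z).re)) _ _)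
      intro z hz
      rcases lt_or_ge ‖z‖ (1 - γ / n) with h | h
      · exact Or.inl ⟨hz, h⟩
      · exact Or.inr ⟨hz, h⟩
    have hk : samplingSum kernel (Λ ∩ {z | ‖z‖ < 1 - γ / n}) (fun z => p.eval z) ≤
        samplingSum (polyKernel n) (Λ ∩ {z | ‖z‖ < 1 - γ / n}) (fun z => p.eval z) := by
      rw [samplingSum_kernel, samplingSum_polyKernel]
      exact ENNReal.tsum_le_tsum fun z => ENNReal.ofReal_le_ofReal
        (mul_le_div_diagKernel n (by positivity) (sq_mem (hΛ z.2.1)) (by positivity))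
    have htail' : samplingSum kernel (Λ ∩ {z | 1 - γ / n ≤ ‖z‖}) (fun z => p.eval z) ≤
        ENNReal.ofReal (A / 2 * normSq fun z => p.eval z) :=
      htail.trans (ENNReal.ofReal_le_ofReal (by gcongr))
    have hfin := hlow.trans (hsplit.trans (add_le_add hk htail'))
    rw [show A * normSq (fun z => p.eval z) = A / 2 * normSq (fun z => p.eval z) +
      A / 2 * normSq (fun z => p.eval z) by ring,
      ENNReal.ofReal_add (by positivity) (by positivity)] at hfin
    exact (ENNReal.add_le_add_iff_right ENNReal.ofReal_ne_top).mp hfin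
  · have hN := normSq_nonneg (fun z => p.eval z)
    have hn' : (0 : ℝ) < n := by exact_mod_cast hn
    rw [samplingSum_polyKernel_le_iff (by positivity)]
    intro F hF
    have h1 := (samplingSum_kernel_le_iff (by positivity)).mp (hup p) F fun l hl => (hF hl).1
    calc ∑ z ∈ F, ‖p.eval z‖ ^ 2 / diagKernel n (‖z‖ ^ 2)
        ≤ ∑ z ∈ F, ((1 - q) ^ 2)⁻¹ * (‖p.eval z‖ ^ 2 * (1 - ‖z‖ ^ 2) ^ 2) := by
          refine Finset.sum_le_sum fun z hz => ?_
          refine div_diagKernel_le n (by positivity) ?_ hq1 (by positivity)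
          have hz1 : ‖z‖ < 1 - γ / n := (hF hz).2
          have hz2 := mem_disk.mp (hΛ (hF hz).1)
          have hz3 : ‖z‖ ^ 2 ≤ Real.exp (-(γ / n)) := by
            have := Real.add_one_le_exp (-(γ / n))
            nlinarith [norm_nonneg z]
          calc (‖z‖ ^ 2) ^ (n / 2 + 1) ≤ Real.exp (-(γ / n)) ^ (n / 2 + 1) := by gcongr
            _ = Real.exp (((n / 2 + 1 : ℕ) : ℝ) * -(γ / n)) := (Real.exp_nat_mul _ _).symm
            _ ≤ q := by
              rw [hq, Real.exp_le_exp]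
              have h2 : (n : ℝ) / 2 ≤ ((n / 2 + 1 : ℕ) : ℝ) := by
                have : n ≤ 2 * (n / 2 + 1) := by lia
                have : (n : ℝ) ≤ 2 * ((n / 2 + 1 : ℕ) : ℝ) := by exact_mod_cast this
                linarith
              have h3 := mul_le_mul_of_nonneg_right h2 (show 0 ≤ γ / n by positivity)
              have h4 : (n : ℝ) / 2 * (γ / n) = γ / 2 := by field_simp
              linarith
      _ = ((1 - q) ^ 2)⁻¹ * ∑ z ∈ F, ‖p.eval z‖ ^ 2 * (1 - ‖z‖ ^ 2) ^ 2 := by rw [Finset.mul_sum]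
      _ ≤ ((1 - q) ^ 2)⁻¹ * (B * normSq fun z => p.eval z) := by gcongr
      _ = _ := by ring

end Truncation

/-! ### Part (ii): weak limits of MZ families -/

section WeakLimit

variable {M : ℕ → Set ℂ} {Λ : Set ℂ}

/-- The test disk has radius R strictly between |l| and 1, so a partner of l closer than R-|l|
cannot lie on ∂D and must belong to `M j`. -/
lemma WeaklyConverges.eventually_exists_mem (h : WeaklyConverges M Λ) {l : ℂ} (hl : l ∈ Λ)
    (hd : l ∈ disk) {U : Set ℂ} (hU : U ∈ 𝓝 l) : ∀ᶠ j in atTop, ∃ μ ∈ M j, μ ∈ U := by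
  rw [mem_disk] at hd
  have hl0 := norm_nonneg l
  set R := (1 + ‖l‖) / 2 with hR
  obtain ⟨δ, hδ, hδU⟩ := Metric.mem_nhds_iff.mp hU
  have hε : 0 < min δ (R - ‖l‖) := lt_min hδ (by linarith)
  have hsub : Metric.closedBall (0 : ℂ) R ⊆ disk := Metric.closedBall_subset_ball (by linarith)
  filter_upwards [(h 0 R (by linarith) hsub).eventually_lt_const (ENNReal.ofReal_pos.mpr hε)]
    with j hj
  rw [Metric.hausdorffEDist_comm] at hj
  obtain ⟨μ, hμ, hlμ⟩ := Metric.exists_edist_lt_of_hausdorffEDist_lt (x := l)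
    (Or.inl ⟨hl, by rw [mem_closedBall_zero_iff]; linarith⟩) hj
  rw [edist_lt_ofReal] at hlμ
  rcases hμ with hμ | hμ
  · exact ⟨μ, hμ.1, hδU (by rw [Metric.mem_ball, dist_comm]; exact hlμ.trans_le (min_le_left _ _))⟩
  · exfalso
    have h1 := hlμ.trans_le (min_le_right _ _)
    rw [mem_sphere_zero_iff_norm] at hμ
    have h2 := norm_sub_norm_le μ l
    rw [dist_comm, dist_eq_norm] at h1
    linarith

/-- The converse approximation: the margin R-r again rules out partners on ∂D. -/
lemma WeaklyConverges.eventually_forall_exists (h : WeaklyConverges M Λ) {r R δ : ℝ} (hR : 0 < R)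
    (hrR : r < R) (hR1 : R < 1) (hδ : 0 < δ) :
    ∀ᶠ j in atTop, ∀ μ ∈ M j, ‖μ‖ ≤ r → ∃ l ∈ Λ, ‖l‖ ≤ R ∧ dist μ l < δ := by
  have hε : 0 < min δ (R - r) := lt_min hδ (by linarith)
  have hsub : Metric.closedBall (0 : ℂ) R ⊆ disk := Metric.closedBall_subset_ball hR1
  filter_upwards [(h 0 R hR hsub).eventually_lt_const (ENNReal.ofReal_pos.mpr hε)]
    with j hj μ hμ hμr
  obtain ⟨l, hl, hlμ⟩ := Metric.exists_edist_lt_of_hausdorffEDist_lt (x := μ)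
    (Or.inl ⟨hμ, by rw [mem_closedBall_zero_iff]; linarith⟩) hj
  rw [edist_lt_ofReal] at hlμ
  rcases hl with hl | hl
  · exact ⟨l, hl.1, mem_closedBall_zero_iff.mp hl.2, hlμ.trans_le (min_le_left _ _)⟩
  · exfalso
    have h1 := hlμ.trans_le (min_le_right _ _)
    rw [mem_sphere_zero_iff_norm] at hl
    have h2 := norm_sub_norm_le l μ
    rw [dist_comm, dist_eq_norm] at h1
    linarith

/-- Upper bounds of sums pass to weak limits. -/
lemma WeaklyConverges.sum_le (h : WeaklyConverges M Λ) (hΛ : Λ ⊆ disk) {g : ℂ → ℝ}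
    (hg : Continuous g) {C : ℝ}
    (hC : ∀ᶠ j in atTop, ∀ F : Finset ℂ, (F : Set ℂ) ⊆ M j → ∑ z ∈ F, g z ≤ C)
    {F : Finset ℂ} (hF : (F : Set ℂ) ⊆ Λ) : ∑ z ∈ F, g z ≤ C := by
  have hε : ∀ ε : ℝ, 0 < ε → ∑ z ∈ F, (g z - ε) ≤ C := by
    intro ε hε
    -- Disjoint neighbourhoods force distinct points of F to have distinct approximants, so no term
    -- is counted twice.
    obtain ⟨U, hU, hdisj⟩ := F.finite_toSet.t2_separation
    have hV : ∀ z : ℂ, U z ∩ {μ | g z - ε < g μ} ∈ 𝓝 z := fun z =>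
      inter_mem ((hU z).2.mem_nhds (hU z).1)
        (hg.continuousAt.eventually_const_lt (by linarith))
    have hev : ∀ᶠ j in atTop, ∀ z ∈ F, ∃ μ ∈ M j, μ ∈ U z ∩ {μ | g z - ε < g μ} :=
      (eventually_all_finset F).mpr fun z hz =>
        h.eventually_exists_mem (hF hz) (hΛ (hF hz)) (hV z)
    obtain ⟨j, hj, hCj⟩ := (hev.and hC).exists
    choose! u huM hu using hj
    have hinj : Set.InjOn u F := by
      intro x hx y hy hxy
      by_contra hne
      have := Set.disjoint_left.mp (hdisj hx hy hne) (hu x hx).1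
      rw [hxy] at this
      exact this (hu y hy).1
    classical
    calc ∑ z ∈ F, (g z - ε) ≤ ∑ z ∈ F, g (u z) :=
          Finset.sum_le_sum fun z hz => le_of_lt (show g z - ε < g (u z) from (hu z hz).2)
      _ = ∑ μ ∈ F.image u, g μ := (Finset.sum_image hinj).symm
      _ ≤ C := hCj _ (by
          intro μ hμ
          obtain ⟨z, hz, rfl⟩ := Finset.mem_image.mp hμ
          exact huM z hz)
  have hc : Continuous fun ε : ℝ => ∑ z ∈ F, (g z - ε) := by fun_prop
  have ht := (hc.tendsto 0).mono_left (nhdsWithin_le_nhds (s := Set.Ioi 0))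
  have := le_of_tendsto ht (mem_of_superset self_mem_nhdsWithin hε)
  simpa using this

/-- An upper sampling bound for polynomials extends to the Bergman space. -/
lemma samplingSum_le_of_forall_polynomial {B : ℝ} (hB : 0 ≤ B) (hΛ : Λ ⊆ disk)
    (h : ∀ p : Polynomial ℂ, samplingSum kernel Λ (fun z => p.eval z) ≤
      ENNReal.ofReal (B * normSq (fun z => p.eval z))) {f : ℂ → ℂ} (hf : MemBergman f) :
    samplingSum kernel Λ f ≤ ENNReal.ofReal (B * normSq f) := by
  obtain ⟨a, ha⟩ := exists_hasSum_of_differentiableOn hf.1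
  rw [samplingSum_kernel_le_iff (mul_nonneg hB (normSq_nonneg _))]
  intro F hF
  have hN : ∀ N, ∑ z ∈ F, ‖partialSum a N z‖ ^ 2 * (1 - ‖z‖ ^ 2) ^ 2 ≤ B * normSq f := by
    intro N
    have h1 := h (partialSumPoly a N)
    rw [eval_partialSumPoly, samplingSum_kernel_le_iff (mul_nonneg hB (normSq_nonneg _)),
      normSq_partialSum] at h1
    exact (h1 F hF).trans (mul_le_mul_of_nonneg_left (sum_le_normSq hf ha N) hB)
  refine le_of_tendsto' (x := atTop) (tendsto_finsetSum _ fun z hz => ?_) hN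
  exact (((tendsto_partialSum (ha z (hΛ (hF hz)))).norm).pow 2).mul_const _

/-- A lower sampling bound for polynomials extends to the Bergman space. -/
lemma le_samplingSum_of_forall_polynomial {A B : ℝ}
    (hB : ∀ f : ℂ → ℂ, MemBergman f → samplingSum kernel Λ f ≤ ENNReal.ofReal (B * normSq f))
    (h : ∀ p : Polynomial ℂ, ENNReal.ofReal (A * normSq (fun z => p.eval z)) ≤
      samplingSum kernel Λ (fun z => p.eval z)) {f : ℂ → ℂ} (hf : MemBergman f) :
    ENNReal.ofReal (A / 2 * normSq f) ≤ samplingSum kernel Λ f := by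
  obtain ⟨a, ha⟩ := exists_hasSum_of_differentiableOn hf.1
  have hN : ∀ N, ENNReal.ofReal (A * normSq (partialSum a N)) ≤ 2 * samplingSum kernel Λ f +
      2 * ENNReal.ofReal (B * normSq (fun z => f z - partialSum a N z)) := by
    intro N
    have h1 := h (partialSumPoly a N)
    rw [eval_partialSumPoly] at h1
    refine h1.trans ?_
    -- The error term is controlled by the upper bound and vanishes as N → ∞; the factor 2 on the
    -- main term turns A into A/2.
    have h2 : samplingSum kernel Λ (partialSum a N) ≤ 2 * samplingSum kernel Λ f +
        2 * samplingSum kernel Λ (fun z => f z - partialSum a N z) := by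
      simp only [samplingSum_kernel]
      rw [← ENNReal.tsum_mul_left, ← ENNReal.tsum_mul_left, ← ENNReal.tsum_add]
      refine ENNReal.tsum_le_tsum fun z => ?_
      rw [← ENNReal.ofReal_ofNat 2, ← ENNReal.ofReal_mul zero_le_two,
        ← ENNReal.ofReal_mul zero_le_two, ← ENNReal.ofReal_add (by positivity) (by positivity)]
      refine ENNReal.ofReal_le_ofReal ?_
      have h3 : ‖partialSum a N z‖ ≤ ‖f z‖ + ‖f z - partialSum a N z‖ := by
        simpa using norm_sub_le (f z) (f z - partialSum a N z)
      have h4 : ‖partialSum a N z‖ ^ 2 ≤ 2 * ‖f z‖ ^ 2 + 2 * ‖f z - partialSum a N z‖ ^ 2 := by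
        nlinarith [norm_nonneg (partialSum a N z),
          sq_nonneg (‖f z‖ - ‖f z - partialSum a N z‖)]
      calc _ ≤ (2 * ‖f z‖ ^ 2 + 2 * ‖f z - partialSum a N z‖ ^ 2) * (1 - ‖(z : ℂ)‖ ^ 2) ^ 2 := by
            gcongr
        _ = _ := by ring
    refine h2.trans ?_
    gcongr
    exact hB _ (hf.sub (memBergman_partialSum a N))
  have hl : Tendsto (fun N => ENNReal.ofReal (A * normSq (partialSum a N))) atTop
      (𝓝 (ENNReal.ofReal (A * normSq f))) := by
    simp only [normSq_partialSum]
    exact ENNReal.tendsto_ofReal ((hasSum_normSq hf ha).tendsto_sum_nat.const_mul A)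
  have hr : Tendsto (fun N => 2 * samplingSum kernel Λ f +
      2 * ENNReal.ofReal (B * normSq (fun z => f z - partialSum a N z))) atTop
      (𝓝 (2 * samplingSum kernel Λ f + 2 * ENNReal.ofReal (B * 0))) := by
    refine tendsto_const_nhds.add (ENNReal.Tendsto.const_mul ?_ (Or.inr (by simp)))
    exact ENNReal.tendsto_ofReal ((tendsto_normSq_sub_partialSum hf ha).const_mul B)
  have h1 := le_of_tendsto_of_tendsto' hl hr hN
  rw [mul_zero, ENNReal.ofReal_zero, mul_zero, add_zero,
    show A * normSq f = 2 * (A / 2 * normSq f) by ring, ENNReal.ofReal_mul zero_le_two,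
    ENNReal.ofReal_ofNat] at h1
  exact (ENNReal.mul_le_mul_iff_right (by simp) (by simp)).mp h1

/-- The upper bound in the definition of a Marcinkiewicz–Zygmund family, at the level `n`. -/
def PolyUpperBound (B : ℝ) (n : ℕ) (S : Set ℂ) : Prop :=
  ∀ p : Polynomial ℂ, p.natDegree ≤ n → ∀ F : Finset ℂ, (F : Set ℂ) ⊆ S →
    ∑ z ∈ F, ‖p.eval z‖ ^ 2 / diagKernel n (‖z‖ ^ 2) ≤ B * normSq (fun z => p.eval z)

lemma exists_pow_le_half {r : ℝ} (hr0 : 0 ≤ r) (hr : r < 1) :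
    ∀ᶠ n : ℕ in atTop, r ^ (n / 2 + 1) ≤ 1 / 2 := by
  have h1 : ∀ᶠ n : ℕ in atTop, r ^ n < 1 / 2 :=
    (tendsto_pow_atTop_nhds_zero_of_lt_one hr0 hr).eventually_lt_const (by norm_num)
  have h2 : Tendsto (fun n : ℕ => n / 2 + 1) atTop atTop :=
    tendsto_atTop_mono (fun n => Nat.le_succ _)
      (Nat.tendsto_div_const_atTop (by norm_num))
  exact (h2.eventually h1).mono fun n hn => hn.le

/-- Near each point of the disk, a Marcinkiewicz–Zygmund family has boundedly many points. -/
lemma exists_nhds_card_le {S : ℕ → Set ℂ} {B : ℝ} (hS : ∀ n, S n ⊆ disk)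
    (hB : ∀ᶠ n in atTop, PolyUpperBound B n (S n)) {l : ℂ} (hl : l ∈ disk) :
    ∃ U ∈ 𝓝 l, ∀ᶠ n in atTop, ∀ F : Finset ℂ, (F : Set ℂ) ⊆ S n → (F : Set ℂ) ⊆ U →
      (F.card : ℝ) ≤ 8 * B := by
  -- The level m depends on l alone, so the test polynomial k_m(·,l), and with it U, is the same for
  -- all n ≥ m.
  obtain ⟨m, hm⟩ := (exists_pow_le_half (by positivity) (sq_mem hl)).exists
  set K := diagKernel m (‖l‖ ^ 2) with hK
  have hKpos : 0 < K := diagKernel_pos m (by positivity)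
  have hKw : 1 / 4 ≤ K * (1 - ‖l‖ ^ 2) ^ 2 := by
    refine le_trans ?_ (sq_le_diagKernel_mul m (by positivity))
    nlinarith
  have hcont : Continuous fun μ => ‖polyKernel m μ l‖ ^ 2 * (1 - ‖μ‖ ^ 2) ^ 2 := by
    have : Continuous fun μ => polyKernel m μ l := by
      rw [polyKernel_eq_partialSum]; exact continuous_partialSum _ _
    fun_prop
  have hself : ‖polyKernel m l l‖ = K := by
    have h1 : polyKernel m l l = (K : ℂ) := by
      rw [polyKernel, Complex.mul_conj', hK, diagKernel]; push_cast; rfl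
    rw [h1, Complex.norm_real, Real.norm_of_nonneg hKpos.le]
  -- At μ = l the weighted value is K²(1-|l|²)² ≥ K/4. Each point of U contributes more than K/8 to
  -- a sum bounded by BK, whence 8B.
  refine ⟨{μ | K / 8 < ‖polyKernel m μ l‖ ^ 2 * (1 - ‖μ‖ ^ 2) ^ 2},
    hcont.continuousAt.eventually_const_lt ?_, ?_⟩
  · simp only [hself]
    have := mul_le_mul_of_nonneg_left hKw hKpos.le
    linarith
  · filter_upwards [hB, eventually_ge_atTop m] with n hn hmn F hF hFU
    have h1 := hn (partialSumPoly (kernelCoeff l) (m + 1))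
      ((natDegree_partialSumPoly_le _ _).trans hmn) F hF
    have he : ∀ z, (partialSumPoly (kernelCoeff l) (m + 1)).eval z = polyKernel m z l := fun z =>
      (congrFun (eval_partialSumPoly _ _) z).trans (congrFun (polyKernel_eq_partialSum m l) z).symm
    rw [eval_partialSumPoly, normSq_polyKernel] at h1
    simp only [he] at h1
    have h2 : F.card * (K / 8) ≤ B * K := by
      rw [← nsmul_eq_mul, ← Finset.sum_const]
      refine le_trans (Finset.sum_le_sum fun μ hμ => ?_) h1
      have h3 : K / 8 < ‖polyKernel m μ l‖ ^ 2 * (1 - ‖μ‖ ^ 2) ^ 2 := hFU hμ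
      exact h3.le.trans (mul_le_div_diagKernel n (by positivity) (sq_mem (hS n (hF hμ)))
        (by positivity))
    nlinarith

lemma normSq_X_pow (m : ℕ) :
    normSq (fun z => (Polynomial.X ^ m : Polynomial ℂ).eval z) = 1 / ((m : ℝ) + 1) := by
  rw [eval_eq_partialSum (n := m) (by simp), normSq_partialSum,
    Finset.sum_eq_single_of_mem m (by simp)]
  · simp
  · intro j _ hj
    simp [Polynomial.coeff_X_pow, hj]

/-- A Marcinkiewicz–Zygmund family has little mass near the boundary. -/
lemma sum_one_div_diagKernel_le {B : ℝ} {n m : ℕ} (hmn : m ≤ n) {S : Set ℂ}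
    (hB : PolyUpperBound B n S) {r : ℝ} (hr0 : 0 ≤ r) (hr : 1 / 2 ≤ r ^ (2 * m))
    {F : Finset ℂ} (hF : (F : Set ℂ) ⊆ S) (hFr : ∀ z ∈ F, r ≤ ‖z‖) :
    ∑ z ∈ F, 1 / diagKernel n (‖z‖ ^ 2) ≤ 2 * B / ((m : ℝ) + 1) := by
  -- The monomial z^m has squared norm 1/(m+1) but squared modulus at least 1/2 where |z| ≥ r.
  have h := hB (Polynomial.X ^ m) (by simpa using hmn) F hF
  rw [normSq_X_pow] at h
  calc ∑ z ∈ F, 1 / diagKernel n (‖z‖ ^ 2)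
      ≤ ∑ z ∈ F, 2 * (‖(Polynomial.X ^ m : Polynomial ℂ).eval z‖ ^ 2 /
          diagKernel n (‖z‖ ^ 2)) := by
        refine Finset.sum_le_sum fun z hz => ?_
        have hk := diagKernel_pos n (x := ‖z‖ ^ 2) (by positivity)
        have h1 : r ^ (2 * m) ≤ ‖z‖ ^ (2 * m) := pow_le_pow_left₀ hr0 (hFr z hz) _
        rw [← mul_div_assoc]
        gcongr
        rw [Polynomial.eval_pow, Polynomial.eval_X, norm_pow, ← pow_mul, mul_comm m 2]
        linarith
    _ ≤ 2 * (B * (1 / ((m : ℝ) + 1))) := by rw [← Finset.mul_sum]; gcongr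
    _ = _ := by ring

/-- The lower bound of a Marcinkiewicz–Zygmund family, up to the local multiplicity, is inherited
by a weak limit. -/
lemma WeaklyConverges.le_sum {S : ℕ → Set ℂ} {φ : ℕ → ℕ} (hφ : StrictMono φ)
    (hW : WeaklyConverges (fun j => S (φ j)) Λ) (hΛ : Λ ⊆ disk) {A B : ℝ} (hA : 0 < A)
    (hB0 : 0 < B) (hS : ∀ n, S n ⊆ disk) (hfin : ∀ᶠ n in atTop, (S n).Finite)
    (hB : ∀ᶠ n in atTop, PolyUpperBound B n (S n))
    (hΛfin : ∀ r : ℝ, r < 1 → (Λ ∩ {z | ‖z‖ ≤ r}).Finite)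
    {p : Polynomial ℂ} (hlow : ∀ᶠ n in atTop, ∀ G : Finset ℂ, (G : Set ℂ) = S n →
      A * normSq (fun z => p.eval z) ≤ ∑ z ∈ G, ‖p.eval z‖ ^ 2 / diagKernel n (‖z‖ ^ 2)) :
    ∃ F : Finset ℂ, (F : Set ℂ) ⊆ Λ ∧ A / (64 * B) * normSq (fun z => p.eval z) ≤
      ∑ z ∈ F, ‖p.eval z‖ ^ 2 * (1 - ‖z‖ ^ 2) ^ 2 := by
  classical
  rcases (normSq_nonneg (fun z => p.eval z)).eq_or_lt with hN | hN
  · exact ⟨∅, by simp, by rw [← hN]; simp⟩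
  set N := normSq (fun z => p.eval z) with hNdef
  set g : ℂ → ℝ := fun z => ‖p.eval z‖ ^ 2 * (1 - ‖z‖ ^ 2) ^ 2 with hg
  have hgc : Continuous g := by
    have := p.continuous
    fun_prop
  obtain ⟨C, hC⟩ := (isCompact_closedBall (0 : ℂ) 1).exists_bound_of_continuousOn
    (f := fun z => ‖p.eval z‖ ^ 2) (by have := p.continuous; fun_prop)
  have hC0 : 0 ≤ C := (norm_nonneg _).trans (hC 0 (by simp))
  -- Here m, and then r, are chosen so that points with |z| > r account for at most half of A‖p‖².
  obtain ⟨m, hm⟩ := exists_nat_gt (C * (2 * B) / (A / 2 * N))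
  have hm' : C * (2 * B / ((m : ℝ) + 1)) ≤ A / 2 * N := by
    rw [div_lt_iff₀ (by positivity)] at hm
    rw [← mul_div_assoc, div_le_iff₀ (by positivity)]
    nlinarith [mul_pos hA hN]
  obtain ⟨r, hr2, hr0, hr1⟩ : ∃ r : ℝ, 1 / 2 ≤ r ^ (2 * m) ∧ 0 < r ∧ r < 1 := by
    have hc : Continuous fun r : ℝ => r ^ (2 * m) := by fun_prop
    have h1 : ∀ᶠ r : ℝ in 𝓝[<] 1, 1 / 2 < r ^ (2 * m) :=
      ((hc.tendsto 1).mono_left nhdsWithin_le_nhds).eventually_const_lt (by norm_num)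
    obtain ⟨r, h, hr⟩ := (h1.and (Ioo_mem_nhdsLT zero_lt_one)).exists
    exact ⟨r, h.le, hr.1, hr.2⟩
  -- The gap between r and R lets points with |z| ≤ r find partners in the finite set Λ ∩ {|z| ≤ R}.
  set R := (1 + r) / 2 with hR
  have hRfin := hΛfin R (by linarith)
  set F := hRfin.toFinset with hFdef
  have hFΛ : (F : Set ℂ) ⊆ Λ := by intro z hz; rw [hFdef, hRfin.coe_toFinset] at hz; exact hz.1
  refine ⟨F, hFΛ, ?_⟩
  have hε : ∀ ε : ℝ, 0 < ε → A / 2 * N ≤ 4 * ∑ l ∈ F, 8 * B * (g l + ε) := by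
    intro ε hε
    have hloc : ∀ l : ℂ, ∃ U : Set ℂ, IsOpen U ∧ (l ∈ F → l ∈ U ∧ (∀ μ ∈ U, g μ ≤ g l + ε) ∧
        ∀ᶠ n in atTop, ∀ G : Finset ℂ, (G : Set ℂ) ⊆ S n → (G : Set ℂ) ⊆ U →
          (G.card : ℝ) ≤ 8 * B) := by
      intro l
      by_cases hl : l ∈ F
      · obtain ⟨U, hU, hcard⟩ := exists_nhds_card_le hS hB (hΛ (hFΛ hl))
        have hV : {μ | g μ < g l + ε} ∈ 𝓝 l :=
          hgc.continuousAt.eventually_lt_const (by linarith)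
        obtain ⟨V, hVsub, hVo, hlV⟩ := mem_nhds_iff.mp (inter_mem hU hV)
        refine ⟨V, hVo, fun _ => ⟨hlV, fun μ hμ => ?_, ?_⟩⟩
        · exact le_of_lt (show g μ < g l + ε from (hVsub hμ).2)
        · exact hcard.mono fun n hn G hG hGV => hn G hG (hGV.trans fun x hx => (hVsub hx).1)
      · exact ⟨∅, isOpen_empty, fun h => absurd h hl⟩
    choose U hUo hU using hloc
    -- By compactness, every point within δ of F lies in some `U l`.
    obtain ⟨δ, hδ, hthick⟩ := F.finite_toSet.isCompact.exists_thickening_subset_open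
      (t := ⋃ l ∈ F, U l) (isOpen_biUnion fun l _ => hUo l)
      (fun l hl => Set.mem_biUnion hl (hU l hl).1)
    have hcards : ∀ᶠ n in atTop, ∀ l ∈ F, ∀ G : Finset ℂ, (G : Set ℂ) ⊆ S n → (G : Set ℂ) ⊆ U l →
        (G.card : ℝ) ≤ 8 * B := (eventually_all_finset F).mpr fun l hl => (hU l hl).2.2
    have hφt := hφ.tendsto_atTop
    obtain ⟨j, hnear, hn⟩ := ((hW.eventually_forall_exists (r := r) (R := R) (by linarith)
      (by linarith) (by linarith) hδ).and (hφt.eventually (hcards.and (hfin.and (hB.and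
        (hlow.and ((exists_pow_le_half hr0.le hr1).and (eventually_ge_atTop m)))))))).exists
    obtain ⟨hcard, hSfin, hUB, hL, hpow, hmn⟩ := hn
    set n := φ j
    set G := hSfin.toFinset with hG
    have hGS : (G : Set ℂ) = S n := hSfin.coe_toFinset
    have hGmem : ∀ z ∈ G, z ∈ S n := fun z hz => hGS ▸ hz
    have hL := hL G hGS
    rw [← Finset.sum_filter_add_sum_filter_not G (fun z => ‖z‖ ≤ r)] at hL
    have hout : ∑ z ∈ G with ¬ ‖z‖ ≤ r, ‖p.eval z‖ ^ 2 / diagKernel n (‖z‖ ^ 2) ≤ A / 2 * N := by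
      have h1 := sum_one_div_diagKernel_le hmn hUB hr0.le hr2 (F := {z ∈ G | ¬ ‖z‖ ≤ r})
        (fun z hz => hGmem z (Finset.mem_filter.mp hz).1)
        (fun z hz => (not_le.mp (Finset.mem_filter.mp hz).2).le)
      refine le_trans ?_ ((mul_le_mul_of_nonneg_left h1 hC0).trans hm')
      rw [Finset.mul_sum]
      refine Finset.sum_le_sum fun z hz => ?_
      have hz1 := mem_disk.mp (hS n (hGmem z (Finset.mem_filter.mp hz).1))
      have hz2 := hC z (by rw [mem_closedBall_zero_iff]; exact hz1.le)
      rw [Real.norm_of_nonneg (by positivity)] at hz2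
      have hk := diagKernel_pos n (x := ‖z‖ ^ 2) (by positivity)
      rw [mul_one_div]
      gcongr
    -- The factor 4 is (1-q)⁻² with q = 1/2, and 8B bounds the points in each `U l`. As ε → 0 this
    -- gives A/2 · N ≤ 32B ∑ g, hence the constant A/(64B).
    have hin : ∑ z ∈ G with ‖z‖ ≤ r, ‖p.eval z‖ ^ 2 / diagKernel n (‖z‖ ^ 2) ≤
        4 * ∑ l ∈ F, 8 * B * (g l + ε) := by
      have hle : ∀ z ∈ {z ∈ G | ‖z‖ ≤ r}, ‖p.eval z‖ ^ 2 / diagKernel n (‖z‖ ^ 2) ≤ 4 * g z := by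
        intro z hz
        have hzr := (Finset.mem_filter.mp hz).2
        have h1 : (‖z‖ ^ 2) ^ (n / 2 + 1) ≤ 1 / 2 := by
          refine le_trans ?_ hpow
          have : ‖z‖ ^ 2 ≤ r := by nlinarith [norm_nonneg z]
          gcongr
        have h2 := div_diagKernel_le n (a := ‖p.eval z‖ ^ 2) (by positivity) h1 (by norm_num)
          (by positivity)
        refine h2.trans (le_of_eq ?_)
        norm_num [hg]
      have hcover : ∀ z ∈ {z ∈ G | ‖z‖ ≤ r}, g z ≤ ∑ l ∈ F, if z ∈ U l then g l + ε else 0 := by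
        intro z hz
        obtain ⟨l, hl, hlR, hzl⟩ := hnear z (hGmem z (Finset.mem_filter.mp hz).1)
          (Finset.mem_filter.mp hz).2
        have hlF : l ∈ F := by rw [hFdef, hRfin.mem_toFinset]; exact ⟨hl, hlR⟩
        have hzU := hthick (Metric.mem_thickening_iff.mpr ⟨l, hlF, hzl⟩)
        obtain ⟨l', hl', hzl'⟩ := Set.mem_iUnion₂.mp hzU
        refine ((hU l' hl').2.1 z hzl').trans ?_
        refine le_trans (by rw [if_pos hzl']) (Finset.single_le_sum (f := fun l =>
          if z ∈ U l then g l + ε else 0) (fun l _ => ?_) hl')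
        have : 0 ≤ g l := by positivity
        split_ifs <;> positivity
      calc _ ≤ ∑ z ∈ G with ‖z‖ ≤ r, 4 * g z := Finset.sum_le_sum hle
        _ ≤ 4 * ∑ z ∈ G with ‖z‖ ≤ r, ∑ l ∈ F, (if z ∈ U l then g l + ε else 0) := by
            rw [← Finset.mul_sum]
            gcongr with z hz
            exact hcover z hz
        _ ≤ _ := by
            rw [Finset.sum_comm]
            gcongr with l hl
            rw [← Finset.sum_filter, Finset.sum_const, nsmul_eq_mul]
            have : 0 ≤ g l := by positivity
            refine mul_le_mul_of_nonneg_right ?_ (by positivity)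
            refine hcard l hl _ (fun z hz => ?_) fun z hz => (Finset.mem_filter.mp hz).2
            exact hGmem z (Finset.mem_filter.mp (Finset.mem_filter.mp hz).1).1
    linarith
  have hc : Continuous fun ε : ℝ => 4 * ∑ l ∈ F, 8 * B * (g l + ε) := by fun_prop
  have ht := (hc.tendsto 0).mono_left (nhdsWithin_le_nhds (s := Set.Ioi 0))
  have h := ge_of_tendsto ht (mem_of_superset self_mem_nhdsWithin hε)
  simp only [add_zero, ← Finset.mul_sum] at h
  rw [div_mul_eq_mul_div, div_le_iff₀ (by positivity)]
  linarith

/-- Weak limits of Marcinkiewicz–Zygmund families are sampling sets. -/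
theorem IsMZFamily.isSampling {S : ℕ → Set ℂ} (hS : IsMZFamily S) {φ : ℕ → ℕ}
    (hφ : StrictMono φ) (hΛ : Λ ⊆ disk) (hW : WeaklyConverges (fun j => S (φ j)) Λ) :
    IsSampling Λ := by
  obtain ⟨hSd, A, B, hA, hB, n₀, h⟩ := hS
  have hUB : ∀ n, n₀ ≤ n → PolyUpperBound B n (S n) := fun n hn p hp =>
    (samplingSum_polyKernel_le_iff (mul_nonneg hB.le (normSq_nonneg _))).mp ((h n hn).2 p hp).2
  have hup : ∀ p : Polynomial ℂ, samplingSum kernel Λ (fun z => p.eval z) ≤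
      ENNReal.ofReal (B * normSq (fun z => p.eval z)) := by
    intro p
    rw [samplingSum_kernel_le_iff (mul_nonneg hB.le (normSq_nonneg _))]
    intro F hF
    refine hW.sum_le hΛ (g := fun z => ‖p.eval z‖ ^ 2 * (1 - ‖z‖ ^ 2) ^ 2)
      (by have := p.continuous; fun_prop) ?_ hF
    -- The fixed p is admissible once φ j ≥ deg p, and k_n ≤ k bounds the k-weighted sum by the
    -- k_n-weighted one.
    filter_upwards [hφ.tendsto_atTop.eventually (eventually_ge_atTop (max n₀ p.natDegree))]
      with j hj F hF
    refine le_trans (Finset.sum_le_sum fun z hz => ?_)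
      (hUB _ ((le_max_left _ _).trans hj) p ((le_max_right _ _).trans hj) F hF)
    exact mul_le_div_diagKernel _ (by positivity) (sq_mem (hSd _ (hF hz))) (by positivity)
  have hupf := fun f hf => samplingSum_le_of_forall_polynomial hB.le hΛ hup (f := f) hf
  have hlow : ∀ p : Polynomial ℂ, ENNReal.ofReal (A / (64 * B) * normSq (fun z => p.eval z)) ≤
      samplingSum kernel Λ (fun z => p.eval z) := by
    intro p
    obtain ⟨F, hF, hle⟩ := hW.le_sum hφ hΛ hA hB hSd
      (eventually_atTop.mpr ⟨n₀, fun n hn => (h n hn).1⟩) (eventually_atTop.mpr ⟨n₀, hUB⟩)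
      (fun r hr => finite_inter_of_norm_le hB.le hup hr) (p := p) (by
        filter_upwards [eventually_ge_atTop (max n₀ p.natDegree)] with n hn G hG
        have h1 := ((h n ((le_max_left _ _).trans hn)).2 p ((le_max_right _ _).trans hn)).1
        have h0 : ∀ s : Finset ℂ, 0 ≤ ∑ z ∈ s, ‖p.eval z‖ ^ 2 / diagKernel n (‖z‖ ^ 2) := fun s =>
          Finset.sum_nonneg fun z _ => div_diagKernel_nonneg n (fun z => p.eval z) z
        refine (ENNReal.ofReal_le_ofReal_iff (h0 G)).mp (h1.trans ?_)
        rw [samplingSum_polyKernel_le_iff (h0 G)]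
        intro F hF
        refine Finset.sum_le_sum_of_subset_of_nonneg ?_
          fun z _ _ => div_diagKernel_nonneg n (fun z => p.eval z) z
        rw [← hG] at hF
        exact_mod_cast hF)
    refine (ENNReal.ofReal_le_ofReal hle).trans ?_
    rw [samplingSum_kernel, ENNReal.ofReal_sum_of_nonneg (fun z _ => by positivity),
      ← Finset.tsum_subtype' F (fun z => ENNReal.ofReal (‖p.eval z‖ ^ 2 * (1 - ‖z‖ ^ 2) ^ 2))]
    exact ENNReal.tsum_mono_subtype
      (fun z => ENNReal.ofReal (‖p.eval z‖ ^ 2 * (1 - ‖z‖ ^ 2) ^ 2)) hF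
  exact ⟨hΛ, A / (64 * B) / 2, B, by positivity, hB, fun f hf =>
    ⟨le_samplingSum_of_forall_polynomial hupf hlow hf, hupf f hf⟩⟩

end WeakLimit

end BergmanMZ

end

theorem theorem1p1 :
    (∀ Λ : Set ℂ, BergmanMZ.IsSampling Λ →
      ∃ γ₀ : ℝ, 0 < γ₀ ∧ ∀ γ : ℝ, 0 < γ → γ < γ₀ →
        BergmanMZ.IsMZFamily (fun n : ℕ => Λ ∩ {z : ℂ | ‖z‖ < 1 - γ / (n : ℝ)})) ∧
    (∀ Λs : ℕ → Set ℂ, BergmanMZ.IsMZFamily Λs →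
      ∀ φ : ℕ → ℕ, StrictMono φ →
        ∀ Λ : Set ℂ, Λ ⊆ BergmanMZ.disk →
          BergmanMZ.WeaklyConverges (fun j => Λs (φ j)) Λ → BergmanMZ.IsSampling Λ) := by
  exact ⟨fun _ hΛ => hΛ.exists_isMZFamily, fun _ hS _ hφ _ hΛ hW => hS.isSampling hφ hΛ hW⟩
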